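/- Let $S$ be a commutative semiring in which every integer $n\ge 1$ is invertible, and fix a countably infinite set of variables. Raw algebraic λ-terms are given by $M,N ::= x \mid \lambda x.M \mid (M)N \mid 0 \mid a.M \mid M+N$ with $a\in S$, up to α-equivalence only. Resource terms are given by $s ::= x\mid \lambda x.s\mid \langle s\rangle \bar t$, where $\bar t=[t_1,\dots,t_n]$ is a resource monomial, i.e. a finite multiset of resource terms; they too are taken up to α-equivalence. A term (resp. monomial) vector is a possibly infinite formal $S$-linear combination of resource terms (resp. monomials) whose set of free variables is finite. The constructors $\lambda x.(-)$, $\langle -\rangle(-)$ and $[-,\dots,-]$ are extended to vectors by (multi)linearity and pointwise finite sums. For a term vector $\sigma$ let $\sigma^n=[\sigma,\dots,\sigma]$ ($n$ times), and let $\sigma^!=\sum_{n\ge 0}\frac1{n!}\,\sigma^n$ be its promotion. The Taylor expansion is $$T(x)=x,\quad T(\lambda x.M)=\lambda x.T(M),\quad T((M)N)=\langle T(M)\rangle\, T(N)^!,$$ $$T(0)=0,\quad T(a.M)=a\,T(M),\quad T(M+N)=T(M)+T(N).$$ The partial derivative $\frac{\partial e}{\partial x}\cdot u$ of a resource term or monomial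 $e$ along a resource term $u$ is the finite sum given by $\frac{\partial x}{\partial x}\cdot u=u$; $\frac{\partial y}{\partial x}\cdot u=0$ for $y\ne x$; $\frac{\partial \lambda y.s}{\partial x}\cdot u=\lambda y.\left(\frac{\partial s}{\partial x}\cdot u\right)$ for $y\neq x$ not free in $u$; $\frac{\partial \langle s\rangle\bar t}{\partial x}\cdot u=\left\langle\frac{\partial s}{\partial x}\cdot u\right\rangle\bar t+\left\langle s\right\rangle\left(\frac{\partial\bar t}{\partial x}\cdot u\right)$; and $\frac{\partial[s_1,\dots,s_n]}{\partial x}\cdot u=\sum_i[s_1,\dots,\frac{\partial s_i}{\partial x}\cdot u,\dots,s_n]$. For a term vector $\sigma$, the substitution $e[\sigma/x]$ is given by $x[\sigma/x]=\sigma$; $y[\sigma/x]=y$ for $y\ne x$; $(\lambda y.s)[\sigma/x]=\lambda y.(s[\sigma/x])$ for $y\ne x$ not free in $\sigma$; $(\langle s\rangle\bar t)[\sigma/x]=\langle s[\sigma/x]\rangle\,\bar t[\sigma/x]$; and $[s_1,\dots,s_n][\sigma/x]=[s_1[\sigma/x],\dots,s_n[\sigma/x]]$. For a resource term $e$ and a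 monomial $\bar s=[s_1,\dots,s_n]$, the multilinear substitution $\partial_x e\cdot\bar s$ is obtained by replacing $x$ in $e$ by a fresh variable $y$, taking the iterated derivative with respect to $y$ along $s_1,\dots,s_n$, and substituting $0$ for $y$ in the result (for a single term, substituting $0$ for $y$ leaves it unchanged if $y$ is not free in it, and gives $0$ otherwise). For vectors, put $\epsilon[\sigma/x]=\sum_e\epsilon_e\, e[\sigma/x]$ and $\partial_x\epsilon\cdot\bar\sigma=\sum_{e,\bar s}\epsilon_e\,\bar\sigma_{\bar s}\ \partial_x e\cdot\bar s$. **Lemma.** Let $M,N$ be raw algebraic λ-terms and $x$ a variable, and let $M[N/x]$ be capture-avoiding substitution. Then $T(M)$ has finitely many free variables; the families $(\partial_x e\cdot\bar s)_{e,\bar s}$ and $(e[T(N)/x])_e$ are summable (for every resource term $t$, only finitely many members have a nonzero coefficient at $t$), so that the sums above are well defined; and $$T(M[N/x])\;=\;\partial_x T(M)\cdot T(N)^!\;=\;T(M)[T(N)/x].$$ -/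

import Mathlib

namespace ResLam

/-! ### Syntax, up to α-equivalence

The fixed countably infinite set of variables is `ℕ`.  Terms up to α-equivalence are represented by
nameless (de Bruijn) terms: the variable `n` occurring below `k` abstractions is bound by
the `n`-th enclosing one if `n < k`, and is the free variable `n - k` otherwise.  The abstraction
`λx.s` with a named variable `x` is `lam (rename (bindVar x) s)`. -/

/-- The renaming that makes `x` the variable `0` and moves every other variable `y` to `y + 1`. -/
def bindVar (x : ℕ) : ℕ → ℕ := fun y => if y = x then 0 else y + 1

/-- The renaming that makes the variable `0` the variable `x` and undoes the shift `y ↦ y + 1`. -/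
def unbindVar (x : ℕ) : ℕ → ℕ
  | 0 => x
  | y + 1 => y

/-- A renaming, extended below a binder. -/
def liftRen (f : ℕ → ℕ) : ℕ → ℕ
  | 0 => 0
  | y + 1 => f y + 1

/-- Raw algebraic λ-terms `x | λx.M | (M) N | 0 | a.M | M + N`, with coefficients in `S`, up to
α-equivalence only. -/
inductive Term (S : Type*) : Type _
  | var (x : ℕ) : Term S
  | lam (M : Term S) : Term S
  | app (M N : Term S) : Term S
  | zero : Term S
  | smul (a : S) (M : Term S) : Term S
  | add (M N : Term S) : Term S

namespace Term

variable {S : Type*}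

def rename : (ℕ → ℕ) → Term S → Term S
  | f, var y => var (f y)
  | f, lam M => lam (rename (liftRen f) M)
  | f, app M N => app (rename f M) (rename f N)
  | _, zero => zero
  | f, smul a M => smul a (rename f M)
  | f, add M N => add (rename f M) (rename f N)

/-- Capture-avoiding substitution `M[N/x]`; the free variables other than `x` are unchanged. -/
def subst : Term S → ℕ → Term S → Term S
  | var y, x, N => if y = x then N else var y
  | lam M, x, N => lam (subst M (x + 1) (rename Nat.succ N))
  | app M P, x, N => app (subst M x N) (subst P x N)
  | zero, _, _ => zero
  | smul a M, x, N => smul a (subst M x N)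
  | add M P, x, N => add (subst M x N) (subst P x N)

end Term

/-- Resource terms in which monomials are still finite sequences. -/
inductive Pre : Type
  | var (x : ℕ) : Pre
  | lam (s : Pre) : Pre
  | app (s : Pre) (n : ℕ) (t : Fin n → Pre) : Pre

namespace Pre

/-- Equality of resource terms up to permutations of the monomials, at all depths. -/
inductive Rel : Pre → Pre → Prop
  | var (x : ℕ) : Rel (var x) (var x)
  | lam {s s' : Pre} : Rel s s' → Rel (lam s) (lam s')
  | app {s s' : Pre} {n n' : ℕ} {t : Fin n → Pre} {t' : Fin n' → Pre} (e : Fin n ≃ Fin n') :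
      Rel s s' → (∀ i, Rel (t i) (t' (e i))) → Rel (app s n t) (app s' n' t')

theorem Rel.refl : ∀ s : Pre, Rel s s
  | .var x => .var x
  | .lam s => .lam (Rel.refl s)
  | .app s _ t => .app (Equiv.refl _) (Rel.refl s) (fun i => Rel.refl (t i))

theorem Rel.symm {s s' : Pre} (h : Rel s s') : Rel s' s := by
  induction h with
  | var x => exact .var x
  | lam _ ih => exact .lam ih
  | @app s s' n n' t t' e _ _ ih iht =>
    refine .app e.symm ih (fun i => ?_)
    have := iht (e.symm i)
    rwa [Equiv.apply_symm_apply] at this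

theorem Rel.trans {s s' s'' : Pre} (h : Rel s s') (h' : Rel s' s'') : Rel s s'' := by
  induction h generalizing s'' with
  | var x => exact h'
  | lam _ ih =>
    cases h' with
    | lam h' => exact .lam (ih h')
  | app e _ _ ih iht =>
    cases h' with
    | app e' h1 h2 => exact .app (e.trans e') (ih h1) (fun i => iht i (h2 (e i)))

instance setoid : Setoid Pre := ⟨Rel, Rel.refl, Rel.symm, Rel.trans⟩

def fold {α : Type*} (v : ℕ → α) (l : α → α) (a : α → Multiset α → α) : Pre → α
  | var x => v x
  | lam s => l (fold v l a s)
  | app s _ t => a (fold v l a s) (Finset.univ.val.map fun i => fold v l a (t i))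

theorem fold_congr {α : Type*} (v : ℕ → α) (l : α → α) (a : α → Multiset α → α) {s s' : Pre}
    (h : Rel s s') : fold v l a s = fold v l a s' := by
  induction h with
  | var x => rfl
  | lam _ ih => simp only [fold, ih]
  | @app s s' n n' t t' e _ _ ih iht =>
    simp only [fold, ih, iht]
    congr 1
    have : (Finset.univ : Finset (Fin n')).val = (Finset.univ : Finset (Fin n)).val.map e := by
      rw [← Finset.map_univ_equiv e]; rfl
    rw [this, Multiset.map_map]
    rfl

end Pre

/-- Resource terms `s, t ::= x | λx.s | ⟨s⟩ m`, where the resource monomial `m` is a finite multiset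
of resource terms, up to α-equivalence. -/
def RTerm : Type := Quotient Pre.setoid

theorem exists_equiv_of_map_eq {α β γ : Type*} [Fintype α] [Fintype β] (f : α → γ) (g : β → γ)
    (h : Finset.univ.val.map f = Finset.univ.val.map g) :
    ∃ e : α ≃ β, ∀ a, g (e a) = f a := by
  classical
  have hc : ∀ c, Nonempty ({a // f a = c} ≃ {b // g b = c}) := fun c => by
    refine ⟨Fintype.equivOfCardEq ?_⟩
    have h1 := congrArg (Multiset.count c) h
    rw [Multiset.count_map, Multiset.count_map] at h1
    rw [Fintype.card_subtype, Fintype.card_subtype]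
    simpa [Finset.card, Finset.filter, eq_comm] using h1
  refine ⟨(Equiv.sigmaFiberEquiv f).symm.trans
    ((Equiv.sigmaCongrRight fun c => (hc c).some).trans (Equiv.sigmaFiberEquiv g)), fun a => ?_⟩
  exact ((hc (f a)).some ⟨a, rfl⟩).2

namespace RTerm

noncomputable section

def var (x : ℕ) : RTerm := Quotient.mk _ (Pre.var x)

def lam : RTerm → RTerm := Quotient.map Pre.lam fun _ _ h => Pre.Rel.lam h

/-- The application `⟨s⟩ m` of a resource term to a resource monomial. -/
def app (s : RTerm) (m : Multiset RTerm) : RTerm :=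
  Quotient.mk _ (Pre.app s.out m.toList.length fun i => (m.toList.get i).out)

theorem mk_app (s : Pre) (n : ℕ) (t : Fin n → Pre) :
    (Quotient.mk _ (Pre.app s n t) : RTerm) =
      app (Quotient.mk _ s) (Finset.univ.val.map fun i => (Quotient.mk _ (t i) : RTerm)) := by
  set m : Multiset RTerm := Finset.univ.val.map fun i => (Quotient.mk _ (t i) : RTerm) with hm
  obtain ⟨e, he⟩ : ∃ e : Fin n ≃ Fin m.toList.length,
      ∀ i, m.toList.get (e i) = (Quotient.mk _ (t i) : RTerm) := by
    apply exists_equiv_of_map_eq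
    rw [← hm]
    conv_lhs => rw [← Multiset.coe_toList m]
    exact (Fin.univ_val_map (m.toList.get)).trans (by rw [List.ofFn_get]) |>.symm
  refine Quotient.sound (Pre.Rel.app e ?_ fun i => ?_)
  · exact Pre.Rel.symm (Quotient.mk_out s)
  · rw [he i]
    exact Pre.Rel.symm (Quotient.mk_out (t i))

/-- Induction over resource terms and monomials. -/
theorem induction {p : RTerm → Prop} (hvar : ∀ x, p (var x)) (hlam : ∀ s, p s → p (lam s))
    (happ : ∀ s m, p s → (∀ t ∈ m, p t) → p (app s m)) (s : RTerm) : p s := by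
  induction s using Quotient.inductionOn with
  | h s =>
    induction s with
    | var x => exact hvar x
    | lam s ih => exact hlam _ ih
    | app s n t ih iht =>
      rw [mk_app]
      refine happ _ _ ih fun u hu => ?_
      obtain ⟨i, -, rfl⟩ := Multiset.mem_map.1 hu
      exact iht i

/-- Definition by iteration. -/
def fold {α : Type*} (v : ℕ → α) (l : α → α) (a : α → Multiset α → α) : RTerm → α :=
  Quotient.lift (Pre.fold v l a) fun _ _ h => Pre.fold_congr v l a h

section

variable {α : Type*} (v : ℕ → α) (l : α → α) (a : α → Multiset α → α)

theorem fold_var (x : ℕ) : fold v l a (var x) = v x := rfl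

theorem fold_lam (s : RTerm) : fold v l a (lam s) = l (fold v l a s) := by
  induction s using Quotient.inductionOn with
  | h s => rfl

theorem fold_app (s : RTerm) (m : Multiset RTerm) :
    fold v l a (app s m) = a (fold v l a s) (m.map (fold v l a)) := by
  have h : ∀ t : RTerm, Pre.fold v l a t.out = fold v l a t := fun t => by
    conv_rhs => rw [← Quotient.out_eq t]
    rfl
  change a (Pre.fold v l a s.out) _ = _
  simp only [h]
  congr 1
  have : m = Finset.univ.val.map m.toList.get := by
    conv_lhs => rw [← Multiset.coe_toList m]
    exact (Fin.univ_val_map (m.toList.get)).trans (by rw [List.ofFn_get]) |>.symm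
  conv_rhs => rw [this, Multiset.map_map]
  rfl

end

/-- Definition by recursion over resource terms and monomials: the clauses for `lam s` and
`app s m` may use both the immediate subterms and the values at these subterms. -/
def recurse {α : Type*} (v : ℕ → α) (l : RTerm → α → α)
    (a : RTerm → α → Multiset (RTerm × α) → α) (s : RTerm) : α :=
  (fold (α := RTerm × α) (fun x => (var x, v x)) (fun p => (lam p.1, l p.1 p.2))
    (fun p m => (app p.1 (m.map Prod.fst), a p.1 p.2 m)) s).2

section

variable {α : Type*} (v : ℕ → α) (l : RTerm → α → α) (a : RTerm → α → Multiset (RTerm × α) → α)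

theorem recurse_fold (s : RTerm) :
    fold (α := RTerm × α) (fun x => (var x, v x)) (fun p => (lam p.1, l p.1 p.2))
      (fun p m => (app p.1 (m.map Prod.fst), a p.1 p.2 m)) s = (s, recurse v l a s) := by
  refine Prod.ext ?_ rfl
  induction s using RTerm.induction with
  | hvar x => rfl
  | hlam s ih => rw [fold_lam]; exact congrArg lam ih
  | happ s m ih ihm =>
    rw [fold_app]
    simp only [ih, Multiset.map_map, Function.comp_def]
    rw [Multiset.map_congr rfl ihm, Multiset.map_id']

theorem recurse_var (x : ℕ) : recurse v l a (var x) = v x := rfl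

theorem recurse_lam (s : RTerm) : recurse v l a (lam s) = l s (recurse v l a s) := by
  conv_lhs => rw [recurse, fold_lam]
  simp only [recurse_fold]

theorem recurse_app (s : RTerm) (m : Multiset RTerm) :
    recurse v l a (app s m) = a s (recurse v l a s) (m.map fun t => (t, recurse v l a t)) := by
  conv_lhs => rw [recurse, fold_app]
  simp only [recurse_fold]

end

theorem var_injective : Function.Injective var := fun _ _ h =>
  congrArg (recurse (fun x => x) (fun _ _ => 0) fun _ _ _ => 0) h

theorem lam_injective : Function.Injective lam := fun s t h => by
  have := congrArg (recurse var (fun s _ => s) fun s _ _ => s) h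
  simpa only [recurse_lam] using this

theorem app_inj {s s' : RTerm} {m m' : Multiset RTerm} (h : app s m = app s' m') :
    s = s' ∧ m = m' := by
  have h1 := congrArg (recurse var (fun s _ => s) fun s _ _ => s) h
  have h2 := congrArg (recurse (fun _ => 0) (fun _ _ => 0) fun _ _ m => m.map Prod.fst) h
  simp only [recurse_app, Multiset.map_map, Function.comp_def, Multiset.map_id'] at h1 h2
  exact ⟨h1, h2⟩

theorem constructors_disjoint (x : ℕ) (s t : RTerm) (m : Multiset RTerm) :
    var x ≠ lam s ∧ var x ≠ app t m ∧ lam s ≠ app t m := by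
  refine ⟨fun h => ?_, fun h => ?_, fun h => ?_⟩ <;>
  · have := congrArg (recurse (fun _ => 0) (fun _ _ => 1) fun _ _ _ => 2) h
    simp [recurse_lam, recurse_app, recurse_var] at this

def rename (s : RTerm) (f : ℕ → ℕ) : RTerm :=
  recurse (α := (ℕ → ℕ) → RTerm)
    (fun y f => var (f y))
    (fun _ r f => lam (r (liftRen f)))
    (fun _ r m f => app (r f) (m.map fun p => p.2 f))
    s f

/-- The set of free variables. -/
def fv (s : RTerm) : Set ℕ :=
  recurse (α := Set ℕ)
    (fun y => {y})
    (fun _ r => {y | y + 1 ∈ r})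
    (fun _ r m => r ∪ {y | ∃ p ∈ m, y ∈ p.2})
    s

/-! ### Partial derivatives

Finite formal sums of resource terms are elements of `RTerm →₀ ℕ`. -/

open Classical in
/-- The partial derivative `∂s/∂x · u`.  The clause for a monomial `[s₁, …, sₙ]` is
`∑ᵢ [s₁, …, ∂sᵢ/∂x · u, …, sₙ]`. -/
def pdiff (s : RTerm) (x : ℕ) (u : RTerm) : RTerm →₀ ℕ :=
  recurse (α := ℕ → RTerm → (RTerm →₀ ℕ))
    (fun y x u => if y = x then Finsupp.single u 1 else 0)
    (fun _ d x u => (d (x + 1) (u.rename Nat.succ)).mapDomain lam)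
    (fun s d m x u =>
      (d x u).mapDomain (fun s' => app s' (m.map Prod.fst)) +
        (m.map fun p => (p.2 x u).mapDomain
          fun t' => app s (t' ::ₘ (m.map Prod.fst).erase p.1)).sum)
    s x u

/-- The derivative of a finite sum of terms. -/
def pdiffSum (ε : RTerm →₀ ℕ) (x : ℕ) (u : RTerm) : RTerm →₀ ℕ :=
  ε.sum fun s c => c • pdiff s x u

/-- The iterated derivative `∂(⋯ ∂s/∂x · u₁ ⋯)/∂x · uₙ`. -/
def npdiff (s : RTerm) (x : ℕ) (us : List RTerm) : RTerm →₀ ℕ :=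
  us.foldl (fun ε u => pdiffSum ε x u) (Finsupp.single s 1)

end

end RTerm

noncomputable section

/-! ### Vectors of resource terms and of resource monomials -/

section Vectors

variable {S : Type*} [CommSemiring S]

/-- A family of vectors is summable if each coefficient is nonzero for finitely many members. -/
def SummableFamily {I X : Type*} (ξ : I → X → S) : Prop :=
  ∀ x, {i | ξ i x ≠ 0}.Finite

/-- The linear-continuous extension of a summable function. -/
def ext {X Y : Type*} (f : X → Y → S) (ξ : X → S) : Y → S :=
  fun y => ∑ᶠ x, ξ x * f x y

/-- The bilinear-continuous extension of a summable binary function. -/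
def ext₂ {X X' Y : Type*} (f : X → X' → Y → S) (ξ : X → S) (ζ : X' → S) : Y → S :=
  fun y => ∑ᶠ p : X × X', ξ p.1 * ζ p.2 * f p.1 p.2 y

open Classical in
/-- An element of `X`, as a vector. -/
def basis {X : Type*} (x : X) : X → S := fun y => if y = x then 1 else 0

/-- Vectors with finitely many free variables. -/
def IsTermVector (σ : RTerm → S) : Prop :=
  (⋃ s ∈ {s | σ s ≠ 0}, s.fv).Finite

def vrename (f : ℕ → ℕ) (σ : RTerm → S) : RTerm → S :=
  ext (fun s => basis (s.rename f)) σ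

def vlam (σ : RTerm → S) : RTerm → S :=
  ext (fun s => basis s.lam) σ

def vapp (σ : RTerm → S) (τ : Multiset RTerm → S) : RTerm → S :=
  ext₂ (fun s m => basis (RTerm.app s m)) σ τ

open Classical in
/-- The monomial vector `[σ₁, …, σₙ] = ∑ (σ₁)_{s₁} ⋯ (σₙ)_{sₙ} . [s₁, …, sₙ]`, the sum being over all
`s₁, …, sₙ`.  It depends only on the multiset `Φ` of the `σᵢ`, whose elements (with repetitions) serve
as the indices. -/
def vbag (Φ : Multiset (RTerm → S)) : Multiset RTerm → S :=
  fun m => ∑ᶠ s : Φ → RTerm, (∏ i : Φ, (i : RTerm → S) (s i)) * basis (Finset.univ.val.map s) m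

/-- The promotion `∑ₙ (1 / n!) . σⁿ`, where `σⁿ = [σ, …, σ]`. -/
def promotion (σ : RTerm → S) : Multiset RTerm → S :=
  fun m => ∑ᶠ n : ℕ, Ring.inverse (n.factorial : S) * vbag (Multiset.replicate n σ) m

/-- The substitution `s[σ/x]` of a vector for a variable in a resource term. -/
def vsubstTerm (s : RTerm) (x : ℕ) (σ : RTerm → S) : RTerm → S :=
  RTerm.recurse (α := ℕ → (RTerm → S) → RTerm → S)
    (fun y x σ => if y = x then σ else basis (RTerm.var y))
    (fun _ r x σ => vlam (r (x + 1) (vrename Nat.succ σ)))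
    (fun _ r m x σ => vapp (r x σ) (vbag (m.map fun p => p.2 x σ)))
    s x σ

/-- The substitution `ε[σ/x]` of a vector for a variable in a vector. -/
def vsubst (ε : RTerm → S) (x : ℕ) (σ : RTerm → S) : RTerm → S :=
  ext (fun s => vsubstTerm s x σ) ε

/-- The multilinear substitution of `m = [s₁, …, sₙ]` for `x` in a resource term `e`: a fresh variable
replaces `x` in `e`, one takes the `n`-th derivative along `m` with respect to this variable, and
one substitutes `0` for it in the result.  Here the fresh variable is `0`, all the others
being shifted by one to make room for it.  The derivative does not depend on the enumeration
of `m`. -/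
def lsubstTerm (e : RTerm) (x : ℕ) (m : Multiset RTerm) : RTerm → ℕ :=
  vrename (unbindVar x) <| vsubst
    (RTerm.npdiff (e.rename (bindVar x)) 0 (m.toList.map fun s => s.rename Nat.succ)) 0 0

/-- The multilinear substitution of a monomial vector for a variable in a term vector. -/
def lsubst (ε : RTerm → S) (x : ℕ) (σ : Multiset RTerm → S) : RTerm → S :=
  ext₂ (fun e m e' => (lsubstTerm e x m e' : S)) ε σ

/-- The Taylor expansion of a term. -/
def taylor : Term S → RTerm → S
  | .var x => basis (RTerm.var x)
  | .lam M => vlam (taylor M)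
  | .app M N => vapp (taylor M) (promotion (taylor N))
  | .zero => 0
  | .smul a M => a • taylor M
  | .add M N => taylor M + taylor N

end Vectors

end

end ResLam

namespace ResLam

noncomputable section

/-! ### Linear-continuous extensions -/

section Extensions

variable {S : Type*} [CommSemiring S] {X Y Z X' Y' : Type*}

/-! The two equalities have separate proofs, joined by `T(M)[T(N)/x]`.

`T(M[N/x]) = T(M)[T(N)/x]` (`taylor_subst`) is an induction on `M`, since substituting a vector
commutes with every constructor. Application needs it to commute with promotion (`promotion_ext`),
and abstraction needs `T` to commute with the shift of variables (`taylor_rename`).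

`∂ₓε · σ^! = ε[σ/x]` (`lsubst_promotion`) is Taylor's formula. It holds for all vectors `ε`, `σ` and
reduces by linearity to one resource term `e`. Let `d` be the number of free occurrences of `x` in
`e`. Only monomials with `d` elements survive the final substitution of `0`, so only `(1/d!) σ^d`
matters, and the claim becomes `∂ₓe · σ^d = d! e[σ/x]`. This is proved by induction on `d`
(`ext_bagDeriv_vbag_replicate`): the terms of a first derivative have `d - 1` occurrences left, and
Euler's identity `(∂e/∂x · σ)[σ/x] = d e[σ/x]` (`vsubst_dirDeriv`) supplies the factor `d`. Euler's
identity requires that the variable not be free in `σ`, which is why one differentiates with respect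
to a fresh variable. Freshness also makes derivatives commute (`vpdiff_comm`), so a derivative along
a multiset does not depend on its enumeration.

Operations on vectors extend operations on resource terms, and identities pass from terms to vectors
through `ext_ext`, `ext_bin_of_hom` and `ext_bin_of_leibniz` once the families are summable.
Summability rests on one finiteness principle (`RTerm.finite_of_size_le`): a term occurring in a
result bounds the size and the free variables of the arguments that produced it. -/

/-- The finite index set depends on `f` and `y` only. One set thus serves all vectors `ξ` at once,
which gives linearity and the exchange of sums below. -/
theorem ext_apply_eq_sum {f : X → Y → S} {ξ : X → S} {y : Y} {A : Finset X}
    (hA : ∀ x, f x y ≠ 0 → x ∈ A) : ext f ξ y = ∑ x ∈ A, ξ x * f x y := by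
  refine finsum_eq_sum_of_support_subset _ fun x hx => ?_
  exact hA x (right_ne_zero_of_mul hx)

theorem SummableFamily.ext_apply {f : X → Y → S} (hf : SummableFamily f) (ξ : X → S) (y : Y) :
    ext f ξ y = ∑ x ∈ (hf y).toFinset, ξ x * f x y :=
  ext_apply_eq_sum fun x hx => by simpa using hx

theorem exists_of_ext_ne_zero {f : X → Y → S} {ξ : X → S} {y : Y} (h : ext f ξ y ≠ 0) :
    ∃ x, ξ x ≠ 0 ∧ f x y ≠ 0 := by
  by_contra! hc
  refine h (finsum_eq_zero_of_forall_eq_zero fun x => ?_)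
  by_cases hx : ξ x = 0
  · rw [hx, zero_mul]
  · rw [hc x hx, mul_zero]

theorem ext_congr {f g : X → Y → S} {ξ : X → S} (h : ∀ x, ξ x ≠ 0 → f x = g x) :
    ext f ξ = ext g ξ := by
  funext y
  refine finsum_congr fun x => ?_
  by_cases hx : ξ x = 0
  · rw [hx, zero_mul, zero_mul]
  · rw [h x hx]

theorem basis_self (x : X) : (basis x : X → S) x = 1 := if_pos rfl

theorem basis_of_ne {x y : X} (h : y ≠ x) : (basis x : X → S) y = 0 := if_neg h

theorem eq_of_basis_ne_zero {x y : X} (h : (basis x : X → S) y ≠ 0) : y = x := by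
  by_contra hc
  exact h (basis_of_ne hc)

theorem ext_basis_apply (f : X → Y → S) (x : X) : ext f (basis x) = f x := by
  funext y
  refine (finsum_eq_single _ x fun x' hx' => ?_).trans ?_
  · rw [basis_of_ne hx', zero_mul]
  · rw [basis_self, one_mul]

theorem ext_basis (ξ : X → S) : ext basis ξ = ξ := by
  funext y
  refine (finsum_eq_single _ y fun x' hx' => ?_).trans ?_
  · rw [basis_of_ne hx'.symm, mul_zero]
  · rw [basis_self, mul_one]

theorem summable_basis_comp {f : X → Y} (hf : ∀ y, {x | f x = y}.Finite) :
    SummableFamily (fun x => (basis (f x) : Y → S)) := fun y =>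
  (hf y).subset fun _ hx => (eq_of_basis_ne_zero hx).symm

theorem summable_basis : SummableFamily (basis : X → X → S) :=
  summable_basis_comp (f := fun x => x) fun y => (Set.finite_singleton y).subset fun _ h => h

theorem ext_zero (f : X → Y → S) : ext f 0 = 0 := by
  funext y
  exact finsum_eq_zero_of_forall_eq_zero fun x => zero_mul _

theorem ext_zero_family (ξ : X → S) : ext (0 : X → Y → S) ξ = 0 := by
  funext y
  exact finsum_eq_zero_of_forall_eq_zero fun x => mul_zero _

theorem ext_add {f : X → Y → S} (hf : SummableFamily f) (ξ ζ : X → S) :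
    ext f (ξ + ζ) = ext f ξ + ext f ζ := by
  funext y
  simp only [Pi.add_apply, hf.ext_apply, add_mul, Finset.sum_add_distrib]

theorem ext_smul {f : X → Y → S} (hf : SummableFamily f) (a : S) (ξ : X → S) :
    ext f (a • ξ) = a • ext f ξ := by
  funext y
  simp only [Pi.smul_apply, hf.ext_apply, smul_eq_mul, mul_assoc, Finset.mul_sum]

theorem ext_add_family {f g : X → Y → S} (hf : SummableFamily f) (hg : SummableFamily g)
    (ξ : X → S) : ext (fun x => f x + g x) ξ = ext f ξ + ext g ξ := by
  classical
  funext y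
  have hA : ∀ x, f x y ≠ 0 → x ∈ (hf y).toFinset ∪ (hg y).toFinset := fun x hx => by simp [hx]
  have hB : ∀ x, g x y ≠ 0 → x ∈ (hf y).toFinset ∪ (hg y).toFinset := fun x hx => by simp [hx]
  have hC : ∀ x, (f x + g x) y ≠ 0 → x ∈ (hf y).toFinset ∪ (hg y).toFinset := fun x hx => by
    by_contra hc
    simp only [Finset.mem_union, Set.Finite.mem_toFinset, Set.mem_ofPred_eq, not_or, not_not] at hc
    exact hx (by rw [Pi.add_apply, hc.1, hc.2, add_zero])
  rw [Pi.add_apply, ext_apply_eq_sum hA, ext_apply_eq_sum hB, ext_apply_eq_sum hC]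
  simp only [Pi.add_apply, mul_add, Finset.sum_add_distrib]

theorem ext_smul_family {f : X → Y → S} (hf : SummableFamily f) (a : S) (ξ : X → S) :
    ext (fun x => a • f x) ξ = a • ext f ξ := by
  rw [← ext_smul hf]
  funext y
  refine finsum_congr fun x => ?_
  simp only [Pi.smul_apply, smul_eq_mul]
  ring

theorem SummableFamily.ext {f : Y → Z → S} {g : X → Y → S} (hf : SummableFamily f)
    (hg : SummableFamily g) : SummableFamily (fun x => ext f (g x)) := fun z => by
  refine ((hf z).biUnion fun y _ => hg y).subset fun x hx => ?_
  obtain ⟨y, hy, hy'⟩ := exists_of_ext_ne_zero hx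
  exact Set.mem_biUnion (show y ∈ {y | f y z ≠ 0} from hy') hy

/-- Fubini: finitely many `y` reach a given `z`, and finitely many `x` reach these `y`, so both
sides are sums over one finite rectangle. -/
theorem ext_ext {f : Y → Z → S} {g : X → Y → S} (hf : SummableFamily f) (hg : SummableFamily g)
    (ξ : X → S) : ext f (ext g ξ) = ext (fun x => ext f (g x)) ξ := by
  classical
  funext z
  set A := (hf z).toFinset with hAdef
  set B := A.biUnion fun y => (hg y).toFinset with hBdef
  have hA : ∀ y, f y z ≠ 0 → y ∈ A := fun y hy => by simpa [hAdef] using hy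
  have hB : ∀ y ∈ A, ∀ x, g x y ≠ 0 → x ∈ B := fun y hy x hx => by
    rw [hBdef, Finset.mem_biUnion]
    exact ⟨y, hy, by simpa using hx⟩
  have hC : ∀ x, ext f (g x) z ≠ 0 → x ∈ B := fun x hx => by
    obtain ⟨y, hy, hy'⟩ := exists_of_ext_ne_zero hx
    exact hB y (hA y hy') x hy
  rw [ext_apply_eq_sum hA, ext_apply_eq_sum hC]
  simp only [ext_apply_eq_sum hA, Finset.mul_sum]
  rw [Finset.sum_comm]
  refine Finset.sum_congr rfl fun y hy => ?_
  rw [ext_apply_eq_sum (hB y hy), Finset.sum_mul]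
  exact Finset.sum_congr rfl fun x _ => mul_assoc _ _ _

/-! ### Tensor products: bilinear extensions as linear ones. -/

/-- The tensor product of two vectors. -/
def tens (ξ : X → S) (ζ : Y → S) : X × Y → S := fun p => ξ p.1 * ζ p.2

theorem ext₂_eq_ext (f : X → X' → Y → S) (ξ : X → S) (ζ : X' → S) :
    ext₂ f ξ ζ = ext (fun p : X × X' => f p.1 p.2) (tens ξ ζ) := rfl

theorem tens_basis (x : X) (y : Y) : tens (basis x : X → S) (basis y) = basis (x, y) := by
  funext p
  by_cases h1 : p.1 = x
  · by_cases h2 : p.2 = y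
    · have hp : p = (x, y) := Prod.ext h1 h2
      subst hp
      simp only [tens, basis_self, mul_one]
    · rw [basis_of_ne (fun h => h2 (congrArg Prod.snd h))]
      simp only [tens, basis_of_ne h2, mul_zero]
  · rw [basis_of_ne (fun h => h1 (congrArg Prod.fst h))]
    simp only [tens, basis_of_ne h1, zero_mul]

theorem SummableFamily.tens {g : X → Y → S} {h : X' → Y' → S} (hg : SummableFamily g)
    (hh : SummableFamily h) : SummableFamily (fun p : X × X' => tens (g p.1) (h p.2)) := fun q =>
  ((hg q.1).prod (hh q.2)).subset fun _ hp =>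
    ⟨left_ne_zero_of_mul hp, right_ne_zero_of_mul hp⟩

theorem tens_ext {g : X → Y → S} {h : X' → Y' → S} (hg : SummableFamily g)
    (hh : SummableFamily h) (ξ : X → S) (ζ : X' → S) :
    tens (ext g ξ) (ext h ζ) = ext (fun p : X × X' => tens (g p.1) (h p.2)) (tens ξ ζ) := by
  funext q
  have hA : ∀ p : X × X', ResLam.tens (g p.1) (h p.2) q ≠ 0 →
      p ∈ (hg q.1).toFinset ×ˢ (hh q.2).toFinset := fun p hp => by
    simpa using ⟨left_ne_zero_of_mul hp, right_ne_zero_of_mul hp⟩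
  rw [ext_apply_eq_sum hA]
  simp only [tens, hg.ext_apply, hh.ext_apply, Finset.sum_mul_sum, Finset.sum_product]
  refine Finset.sum_congr rfl fun x _ => Finset.sum_congr rfl fun x' _ => ?_
  ring

theorem tens_ext_left {g : X → Y → S} (hg : SummableFamily g) (ξ : X → S) (ζ : X' → S) :
    tens (ext g ξ) ζ = ext (fun x => tens (g x) ζ) ξ := by
  funext q
  have hA : ∀ x : X, tens (g x) ζ q ≠ 0 → x ∈ (hg q.1).toFinset := fun x hx => by
    simpa using left_ne_zero_of_mul hx
  rw [ext_apply_eq_sum hA]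
  simp only [tens, hg.ext_apply, Finset.sum_mul, mul_assoc]

theorem tens_ext_right {g : X → Y → S} (hg : SummableFamily g) (ξ : X → S) (ζ : X' → S) :
    tens ζ (ext g ξ) = ext (fun x => tens ζ (g x)) ξ := by
  funext q
  have hA : ∀ x : X, tens ζ (g x) q ≠ 0 → x ∈ (hg q.2).toFinset := fun x hx => by
    simpa using right_ne_zero_of_mul hx
  rw [ext_apply_eq_sum hA]
  simp only [tens, hg.ext_apply, Finset.mul_sum]
  refine Finset.sum_congr rfl fun x _ => ?_
  ring

theorem ext₂_eq_ext_ext {f : X → X' → Y → S}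
    (hf : SummableFamily fun p : X × X' => f p.1 p.2) (ξ : X → S) (ζ : X' → S) :
    ext₂ f ξ ζ = ext (fun x => ext (f x) ζ) ξ := by
  classical
  funext y
  set A := (hf y).toFinset.image Prod.fst with hA
  set B := (hf y).toFinset.image Prod.snd with hB
  have h1 : ∀ p : X × X', f p.1 p.2 y ≠ 0 → p ∈ A ×ˢ B := fun p hp => by
    have hp' : p ∈ (hf y).toFinset := by simpa using hp
    exact Finset.mk_mem_product (Finset.mem_image_of_mem _ hp') (Finset.mem_image_of_mem _ hp')
  have h2 : ∀ x x', f x x' y ≠ 0 → x' ∈ B := fun x x' hx =>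
    (Finset.mem_product.1 (h1 (x, x') hx)).2
  have h3 : ∀ x, ext (f x) ζ y ≠ 0 → x ∈ A := fun x hx => by
    obtain ⟨x', _, hx'⟩ := exists_of_ext_ne_zero hx
    exact (Finset.mem_product.1 (h1 (x, x') hx')).1
  rw [ext₂_eq_ext, ext_apply_eq_sum h1, ext_apply_eq_sum h3, Finset.sum_product]
  refine Finset.sum_congr rfl fun x _ => ?_
  rw [ext_apply_eq_sum (h2 x), Finset.mul_sum]
  simp only [tens, mul_assoc]

/-! ### Binary operations with finite fibres. -/

/-- The bilinear-continuous extension of a binary operation. -/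
def bin (o : X → Y → Z) (ξ : X → S) (ζ : Y → S) : Z → S :=
  ext₂ (fun x y => basis (o x y)) ξ ζ

/-- The fibres of a binary operation are finite. -/
def FiniteFibres₂ (o : X → Y → Z) : Prop := ∀ z, {p : X × Y | o p.1 p.2 = z}.Finite

section bin

variable {o : X → Y → Z} (ho : FiniteFibres₂ o)

theorem exists_of_bin_ne_zero {ξ : X → S} {ζ : Y → S} {z : Z} (h : bin o ξ ζ z ≠ 0) :
    ∃ x y, z = o x y ∧ ξ x ≠ 0 ∧ ζ y ≠ 0 := by
  obtain ⟨p, hp, hp'⟩ := exists_of_ext_ne_zero (f := fun p : X × Y => basis (o p.1 p.2)) h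
  exact ⟨p.1, p.2, eq_of_basis_ne_zero hp', left_ne_zero_of_mul hp, right_ne_zero_of_mul hp⟩

theorem bin_basis (x : X) (y : Y) : bin o (basis x : X → S) (basis y) = basis (o x y) := by
  rw [bin, ext₂_eq_ext, tens_basis, ext_basis_apply]

theorem bin_zero_left (ζ : Y → S) : bin o 0 ζ = 0 := by
  have : tens (0 : X → S) ζ = 0 := funext fun p => zero_mul _
  rw [bin, ext₂_eq_ext, this, ext_zero]

theorem bin_zero_right (ξ : X → S) : bin o ξ 0 = 0 := by
  have : tens ξ (0 : Y → S) = 0 := funext fun p => mul_zero _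
  rw [bin, ext₂_eq_ext, this, ext_zero]

include ho

theorem FiniteFibres₂.summable :
    SummableFamily fun p : X × Y => (basis (o p.1 p.2) : Z → S) :=
  summable_basis_comp ho

theorem bin_smul_left (a : S) (ξ : X → S) (ζ : Y → S) :
    bin o (a • ξ) ζ = a • bin o ξ ζ := by
  have : tens (a • ξ) ζ = a • tens ξ ζ := funext fun p => mul_assoc _ _ _
  simp only [bin, ext₂_eq_ext, this, ext_smul ho.summable]

theorem bin_smul_right (a : S) (ξ : X → S) (ζ : Y → S) :
    bin o ξ (a • ζ) = a • bin o ξ ζ := by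
  have : tens ξ (a • ζ) = a • tens ξ ζ := funext fun p => mul_left_comm _ _ _
  simp only [bin, ext₂_eq_ext, this, ext_smul ho.summable]

theorem bin_ext {g : X' → X → S} {h : Y' → Y → S} (hg : SummableFamily g)
    (hh : SummableFamily h) (ξ : X' → S) (ζ : Y' → S) :
    bin o (ext g ξ) (ext h ζ) = ext (fun p : X' × Y' => bin o (g p.1) (h p.2)) (tens ξ ζ) := by
  simp only [bin, ext₂_eq_ext, tens_ext hg hh, ext_ext ho.summable (hg.tens hh)]

theorem summable_bin {g : X' → X → S} {h : Y' → Y → S} (hg : SummableFamily g)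
    (hh : SummableFamily h) : SummableFamily fun p : X' × Y' => bin o (g p.1) (h p.2) :=
  ho.summable.ext (hg.tens hh)

theorem bin_ext_left {g : X' → X → S} (hg : SummableFamily g) (ξ : X' → S) (ζ : Y → S) :
    bin o (ext g ξ) ζ = ext (fun x => bin o (g x) ζ) ξ := by
  have hs : SummableFamily fun x => tens (g x) ζ := fun q =>
    (hg q.1).subset fun _ hp => left_ne_zero_of_mul hp
  simp only [bin, ext₂_eq_ext, tens_ext_left hg, ext_ext ho.summable hs]

theorem bin_ext_right {g : X' → Y → S} (hg : SummableFamily g) (ξ : X' → S) (ζ : X → S) :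
    bin o ζ (ext g ξ) = ext (fun x => bin o ζ (g x)) ξ := by
  have hs : SummableFamily fun x => tens ζ (g x) := fun q =>
    (hg q.2).subset fun _ hp => right_ne_zero_of_mul hp
  simp only [bin, ext₂_eq_ext, tens_ext_right hg, ext_ext ho.summable hs]

theorem bin_basis_right (ξ : X → S) (y : Y) :
    bin o ξ (basis y) = ext (fun x => basis (o x y)) ξ := by
  conv_lhs => rw [← ext_basis ξ, bin_ext_left ho summable_basis]
  simp only [bin_basis]

theorem bin_basis_left (x : X) (ζ : Y → S) :
    bin o (basis x) ζ = ext (fun y => basis (o x y)) ζ := by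
  conv_lhs => rw [← ext_basis ζ, bin_ext_right ho summable_basis]
  simp only [bin_basis]

theorem ext_bin {h : Z → X' → S} (hh : SummableFamily h) (ξ : X → S) (ζ : Y → S) :
    ext h (bin o ξ ζ) = ext₂ (fun x y => h (o x y)) ξ ζ := by
  simp only [bin, ext₂_eq_ext, ext_ext hh ho.summable, ext_basis_apply]

/-- A multiplicative extension commutes with the extension of binary operations. -/
theorem ext_bin_of_hom {Z' : Type*} {o' : X' → Y' → Z'} (ho' : FiniteFibres₂ o')
    {h : Z → Z' → S} (hh : SummableFamily h)
    {g : X → X' → S} (hg : SummableFamily g) {k : Y → Y' → S} (hk : SummableFamily k)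
    (H : ∀ x y, h (o x y) = bin o' (g x) (k y)) (ξ : X → S) (ζ : Y → S) :
    ext h (bin o ξ ζ) = bin o' (ext g ξ) (ext k ζ) := by
  simp only [ext_bin ho hh, H, bin_ext ho' hg hk, ext₂_eq_ext]

/-- The Leibniz rule extends from elements to vectors. -/
theorem ext_bin_of_leibniz {h : Z → Z → S} (hh : SummableFamily h)
    {g : X → X → S} (hg : SummableFamily g) {k : Y → Y → S} (hk : SummableFamily k)
    (H : ∀ x y, h (o x y) = bin o (g x) (basis y) + bin o (basis x) (k y))
    (ξ : X → S) (ζ : Y → S) :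
    ext h (bin o ξ ζ) = bin o (ext g ξ) ζ + bin o ξ (ext k ζ) := by
  simp only [ext_bin ho hh, H, ext₂_eq_ext]
  rw [ext_add_family (summable_bin ho hg summable_basis) (summable_bin ho summable_basis hk),
    ← bin_ext ho hg summable_basis, ← bin_ext ho summable_basis hk, ext_basis, ext_basis]

end bin

/-! ### Finite formal sums as vectors. -/

/-- A finite formal sum, as a vector. -/
def ofFinsupp (ε : X →₀ ℕ) : X → S := fun x => (ε x : S)

theorem ofFinsupp_zero : (ofFinsupp (0 : X →₀ ℕ) : X → S) = 0 := by
  funext x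
  simp [ofFinsupp]

theorem ofFinsupp_add (ε δ : X →₀ ℕ) :
    (ofFinsupp (ε + δ) : X → S) = ofFinsupp ε + ofFinsupp δ := by
  funext x
  simp [ofFinsupp]

theorem ofFinsupp_nsmul (n : ℕ) (ε : X →₀ ℕ) :
    (ofFinsupp (n • ε) : X → S) = (n : S) • ofFinsupp ε := by
  funext x
  simp [ofFinsupp]

theorem ofFinsupp_single (x : X) : (ofFinsupp (Finsupp.single x 1) : X → S) = basis x := by
  funext y
  by_cases h : y = x
  · subst h
    simp [ofFinsupp, basis_self]
  · simp [ofFinsupp, basis_of_ne h, Ne.symm h]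

theorem ofFinsupp_sum {f : X → Y →₀ ℕ}
    (hf : SummableFamily fun x => (ofFinsupp (f x) : Y → S)) (ε : X →₀ ℕ) :
    (ofFinsupp (ε.sum fun x c => c • f x) : Y → S) =
      ext (fun x => ofFinsupp (f x)) (ofFinsupp ε) := by
  classical
  induction ε using Finsupp.induction_linear with
  | zero => rw [Finsupp.sum_zero_index, ofFinsupp_zero, ofFinsupp_zero, ext_zero]
  | add ε δ h1 h2 =>
    rw [Finsupp.sum_add_index' (h := fun x c => c • f x) (fun _ => zero_smul _ _)
      (fun _ _ _ => add_smul _ _ _),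
      ofFinsupp_add, ofFinsupp_add, h1, h2, ext_add hf]
  | single x n =>
    have : Finsupp.single x n = n • Finsupp.single x 1 := by simp
    rw [Finsupp.sum_single_index (h := fun x c => c • f x) (zero_smul _ _), this,
      ofFinsupp_nsmul, ofFinsupp_nsmul, ofFinsupp_single, ext_smul hf, ext_basis_apply]

theorem ofFinsupp_mapDomain {f : X → Y} (hf : ∀ y, {x | f x = y}.Finite) (ε : X →₀ ℕ) :
    (ofFinsupp (ε.mapDomain f) : Y → S) = ext (fun x => basis (f x)) (ofFinsupp ε) := by
  have h := ofFinsupp_sum (S := S) (f := fun x => Finsupp.single (f x) 1)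
    (by simpa only [ofFinsupp_single] using summable_basis_comp hf) ε
  simp only [ofFinsupp_single] at h
  rw [← h, Finsupp.mapDomain]
  simp

end Extensions

end

end ResLam

namespace ResLam

noncomputable section

/-! ### Size, degree and free variables -/

namespace RTerm

/-- The number of constructors of a resource term. -/
def size (s : RTerm) : ℕ :=
  fold (fun _ => 1) (fun r => r + 1) (fun r m => r + m.sum + 1) s

/-- The number of free occurrences of a variable. -/
def deg (x : ℕ) (s : RTerm) : ℕ :=
  fold (α := ℕ → ℕ) (fun y x => if y = x then 1 else 0) (fun r x => r (x + 1))
    (fun r m x => r x + (m.map fun d => d x).sum) s x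

theorem size_var (x : ℕ) : (var x).size = 1 := rfl

theorem size_lam (s : RTerm) : s.lam.size = s.size + 1 := fold_lam _ _ _ _

theorem size_app (s : RTerm) (m : Multiset RTerm) :
    (app s m).size = s.size + (m.map size).sum + 1 := fold_app _ _ _ _ _

theorem one_le_size (s : RTerm) : 1 ≤ s.size := by
  induction s using RTerm.induction with
  | hvar x => exact le_rfl
  | hlam s _ => rw [size_lam]; omega
  | happ s m _ _ => rw [size_app]; omega

theorem deg_var (x y : ℕ) : deg x (var y) = if y = x then 1 else 0 := rfl

theorem deg_lam (x : ℕ) (s : RTerm) : deg x s.lam = deg (x + 1) s :=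
  congrFun (fold_lam _ _ _ _) x

theorem deg_app (x : ℕ) (s : RTerm) (m : Multiset RTerm) :
    deg x (app s m) = deg x s + (m.map (deg x)).sum := by
  refine (congrFun (fold_app _ _ _ _ _) x).trans ?_
  rw [Multiset.map_map]
  rfl

theorem fv_var (x : ℕ) : (var x).fv = {x} := rfl

theorem fv_lam (s : RTerm) : s.lam.fv = {y | y + 1 ∈ s.fv} := recurse_lam _ _ _ _

theorem fv_app (s : RTerm) (m : Multiset RTerm) :
    (app s m).fv = s.fv ∪ {y | ∃ t ∈ m, y ∈ t.fv} := by
  refine (recurse_app _ _ _ _ _).trans ?_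
  simp only [Multiset.mem_map, exists_exists_and_eq_and]
  rfl

theorem finite_fv (s : RTerm) : s.fv.Finite := by
  induction s using RTerm.induction with
  | hvar x => exact Set.finite_singleton x
  | hlam s ih =>
    rw [fv_lam]
    exact ih.preimage (add_left_injective 1).injOn
  | happ s m ih ihm =>
    rw [fv_app]
    refine ih.union (((Multiset.finite_toSet m).biUnion ihm).subset ?_)
    rintro y ⟨t, ht, hy⟩
    exact Set.mem_biUnion (show t ∈ {t | t ∈ m} from ht) hy

theorem deg_le_size (x : ℕ) (s : RTerm) : deg x s ≤ s.size := by
  induction s using RTerm.induction generalizing x with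
  | hvar y => rw [deg_var, size_var]; split_ifs <;> simp
  | hlam s ih => rw [deg_lam, size_lam]; exact (ih _).trans (Nat.le_succ _)
  | happ s m ih ihm =>
    rw [deg_app, size_app]
    have := Multiset.sum_map_le_sum_map (deg x) size fun t ht => ihm t ht x
    have := ih x
    omega

/-! ### Renamings -/

theorem rename_var (x : ℕ) (f : ℕ → ℕ) : (var x).rename f = var (f x) := rfl

theorem rename_lam (s : RTerm) (f : ℕ → ℕ) : s.lam.rename f = (s.rename (liftRen f)).lam :=
  congrFun (recurse_lam _ _ _ _) f

theorem rename_app (s : RTerm) (m : Multiset RTerm) (f : ℕ → ℕ) :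
    (app s m).rename f = app (s.rename f) (m.map fun t => t.rename f) := by
  refine (congrFun (recurse_app _ _ _ _ _) f).trans ?_
  rw [Multiset.map_map]
  rfl

theorem size_rename (s : RTerm) (f : ℕ → ℕ) : (s.rename f).size = s.size := by
  induction s using RTerm.induction generalizing f with
  | hvar y => rfl
  | hlam s ih => rw [rename_lam, size_lam, size_lam, ih]
  | happ s m ih ihm =>
    rw [rename_app, size_app, size_app, ih, Multiset.map_map]
    congr 3
    exact Multiset.map_congr rfl fun t ht => ihm t ht f

theorem fv_rename (s : RTerm) (f : ℕ → ℕ) : (s.rename f).fv = f '' s.fv := by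
  induction s using RTerm.induction generalizing f with
  | hvar y => rw [rename_var, fv_var, fv_var, Set.image_singleton]
  | hlam s ih =>
    rw [rename_lam, fv_lam, fv_lam, ih]
    ext y
    constructor
    · rintro ⟨z, hz, hzy⟩
      cases z with
      | zero => simp [liftRen] at hzy
      | succ z => exact ⟨z, hz, by simpa [liftRen] using hzy⟩
    · rintro ⟨z, hz, rfl⟩
      exact ⟨z + 1, hz, rfl⟩
  | happ s m ih ihm =>
    rw [rename_app, fv_app, fv_app, ih, Set.image_union]
    congr 1
    ext y
    constructor
    · rintro ⟨t, ht, hy⟩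
      obtain ⟨u, hu, rfl⟩ := Multiset.mem_map.1 ht
      rw [ihm u hu] at hy
      obtain ⟨z, hz, rfl⟩ := hy
      exact ⟨z, ⟨u, hu, hz⟩, rfl⟩
    · rintro ⟨z, ⟨t, ht, hz⟩, rfl⟩
      refine ⟨_, Multiset.mem_map_of_mem _ ht, ?_⟩
      rw [ihm t ht]
      exact ⟨z, hz, rfl⟩

theorem liftRen_comp (f g : ℕ → ℕ) : liftRen g ∘ liftRen f = liftRen (g ∘ f) := by
  funext y
  cases y <;> rfl

theorem liftRen_id : liftRen id = id := by
  funext y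
  cases y <;> rfl

theorem rename_rename (s : RTerm) (f g : ℕ → ℕ) :
    (s.rename f).rename g = s.rename (g ∘ f) := by
  induction s using RTerm.induction generalizing f g with
  | hvar y => rfl
  | hlam s ih => rw [rename_lam, rename_lam, rename_lam, ih, liftRen_comp]
  | happ s m ih ihm =>
    rw [rename_app, rename_app, rename_app, ih, Multiset.map_map]
    exact congrArg _ (Multiset.map_congr rfl fun t ht => ihm t ht f g)

theorem rename_id (s : RTerm) : s.rename id = s := by
  induction s using RTerm.induction with
  | hvar y => rfl
  | hlam s ih => rw [rename_lam, liftRen_id, ih]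
  | happ s m ih ihm =>
    rw [rename_app, ih, Multiset.map_congr rfl ihm, Multiset.map_id']

/-- No other variable may be merged with `x`; `f` need not be injective elsewhere. -/
theorem deg_rename {f : ℕ → ℕ} {x : ℕ} (hf : ∀ y, f y = f x → y = x) (s : RTerm) :
    deg (f x) (s.rename f) = deg x s := by
  induction s using RTerm.induction generalizing f x with
  | hvar y =>
    have : f y = f x ↔ y = x := ⟨hf y, fun h => h ▸ rfl⟩
    simp only [rename_var, deg_var, this]
  | hlam s ih =>
    rw [rename_lam, deg_lam, deg_lam]
    refine ih (f := liftRen f) (x := x + 1) fun y hy => ?_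
    cases y with
    | zero => simp [liftRen] at hy
    | succ y => rw [hf y (by simpa [liftRen] using hy)]
  | happ s m ih ihm =>
    rw [rename_app, deg_app, deg_app, ih hf, Multiset.map_map]
    congr 2
    exact Multiset.map_congr rfl fun t ht => ihm t ht hf

theorem deg_succ_rename_succ (x : ℕ) (s : RTerm) :
    deg (x + 1) (s.rename Nat.succ) = deg x s :=
  deg_rename (f := Nat.succ) (fun _ h => Nat.succ.inj h) s

theorem deg_eq_zero_iff {x : ℕ} {s : RTerm} : deg x s = 0 ↔ x ∉ s.fv := by
  induction s using RTerm.induction generalizing x with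
  | hvar y => rw [deg_var, fv_var]; simp [eq_comm]
  | hlam s ih => rw [deg_lam, fv_lam, ih]; rfl
  | happ s m ih ihm =>
    rw [deg_app, fv_app, add_eq_zero, ih, Multiset.sum_eq_zero_iff]
    simp only [Multiset.mem_map, forall_exists_index, and_imp, forall_apply_eq_imp_iff₂,
      Set.mem_union, Set.mem_ofPred_eq, not_or, not_exists, not_and]
    exact and_congr_right fun _ => forall₂_congr fun t ht => ihm t ht

theorem deg_zero_rename_succ (s : RTerm) : deg 0 (s.rename Nat.succ) = 0 := by
  rw [deg_eq_zero_iff, fv_rename]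
  rintro ⟨y, -, hy⟩
  exact Nat.succ_ne_zero y hy

end RTerm

/-! ### Finiteness -/

theorem finite_multiset_of_card_le {X : Type*} {A : Set X} (hA : A.Finite) (n : ℕ) :
    {m : Multiset X | Multiset.card m ≤ n ∧ ∀ x ∈ m, x ∈ A}.Finite := by
  induction n with
  | zero =>
    refine (Set.finite_singleton 0).subset fun m hm => ?_
    exact Multiset.card_eq_zero.1 (Nat.le_zero.1 hm.1)
  | succ n ih =>
    refine ((Set.finite_singleton 0).union (hA.image2 Multiset.cons ih)).subset fun m hm => ?_
    induction m using Multiset.induction_on with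
    | empty => exact Or.inl rfl
    | cons x m _ =>
      refine Or.inr ⟨x, hm.2 x (Multiset.mem_cons_self x m), m, ⟨?_, fun y hy => ?_⟩, rfl⟩
      · have := hm.1
        rw [Multiset.card_cons] at this
        omega
      · exact hm.2 y (Multiset.mem_cons_of_mem hy)

theorem finite_multiset_of_rel {X Y : Type*} {r : X → Y → Prop} (m : Multiset Y)
    (h : ∀ y ∈ m, {x | r x y}.Finite) : {m' : Multiset X | Multiset.Rel r m' m}.Finite := by
  refine (finite_multiset_of_card_le ((Multiset.finite_toSet m).biUnion h)
    (Multiset.card m)).subset fun m' hm' => ?_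
  refine ⟨(Multiset.card_eq_card_of_rel hm').le, fun x hx => ?_⟩
  obtain ⟨y, hy, hr⟩ := Multiset.exists_mem_of_rel_of_mem hm' hx
  exact Set.mem_biUnion (show y ∈ {y | y ∈ m} from hy) hr

theorem RTerm.size_le_sum {t : RTerm} {m : Multiset RTerm} (h : t ∈ m) :
    t.size ≤ (m.map RTerm.size).sum :=
  Multiset.le_sum_of_mem (Multiset.mem_map_of_mem _ h)

theorem RTerm.card_le_sum_size (m : Multiset RTerm) :
    Multiset.card m ≤ (m.map RTerm.size).sum := by
  induction m using Multiset.induction_on with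
  | empty => simp
  | cons t m ih =>
    rw [Multiset.card_cons, Multiset.map_cons, Multiset.sum_cons]
    have := t.one_le_size
    omega

/-- There are finitely many resource terms of bounded size with free variables in a finite set. -/
theorem RTerm.finite_of_size_le (n : ℕ) {V : Set ℕ} (hV : V.Finite) :
    {s : RTerm | s.size ≤ n ∧ s.fv ⊆ V}.Finite := by
  induction n generalizing V with
  | zero =>
    refine Set.finite_empty.subset fun s hs => ?_
    have := s.one_le_size
    exact absurd hs.1 (by omega)
  | succ n ih =>
    -- The body of an abstraction may use the bound variable `0` and the shifted variables of `V`.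
    have hV' : (insert 0 (Nat.succ '' V)).Finite := (hV.image _).insert _
    refine ((hV.image RTerm.var).union (((ih hV').image RTerm.lam).union
      ((ih hV).image2 RTerm.app (finite_multiset_of_card_le (ih hV) n)))).subset fun s hs => ?_
    obtain ⟨hs, hsV⟩ := hs
    induction s using RTerm.induction with
    | hvar x => exact Or.inl ⟨x, hsV rfl, rfl⟩
    | hlam s _ =>
      rw [RTerm.size_lam] at hs
      rw [RTerm.fv_lam] at hsV
      refine Or.inr (Or.inl ⟨s, ⟨by omega, fun y hy => ?_⟩, rfl⟩)
      cases y with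
      | zero => exact Or.inl rfl
      | succ y => exact Or.inr ⟨y, hsV hy, rfl⟩
    | happ s m _ _ =>
      rw [RTerm.size_app] at hs
      rw [RTerm.fv_app] at hsV
      have h1 := RTerm.card_le_sum_size m
      refine Or.inr (Or.inr ⟨s, ⟨by omega, fun y hy => hsV (Or.inl hy)⟩, m,
        ⟨by omega, fun t ht => ⟨?_, fun y hy => hsV (Or.inr ⟨t, ht, hy⟩)⟩⟩, rfl⟩)
      have := RTerm.size_le_sum ht
      omega

/-- Renaming preserves size, and the free variables of a preimage lie in the finite set `f ⁻¹'
t.fv`. -/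
theorem RTerm.finite_rename_eq {f : ℕ → ℕ} (hf : ∀ y, {x | f x = y}.Finite) (t : RTerm) :
    {s : RTerm | s.rename f = t}.Finite := by
  have hV : (f ⁻¹' t.fv).Finite := by
    rw [← Set.biUnion_preimage_singleton]
    exact t.finite_fv.biUnion fun y _ => hf y
  refine (RTerm.finite_of_size_le t.size hV).subset ?_
  rintro s rfl
  refine ⟨(s.size_rename f).ge, fun y hy => ?_⟩
  rw [Set.mem_preimage, RTerm.fv_rename]
  exact ⟨y, hy, rfl⟩

theorem finite_fibre_of_injective {X Y : Type*} {f : X → Y} (hf : Function.Injective f) (y : Y) :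
    {x | f x = y}.Finite :=
  Set.Subsingleton.finite fun _ ha _ hb => hf (ha.trans (Eq.symm hb))

theorem finiteFibres_app : FiniteFibres₂ RTerm.app := fun z =>
  Set.Subsingleton.finite fun p hp q hq => by
    have h : RTerm.app p.1 p.2 = RTerm.app q.1 q.2 := hp.trans (Eq.symm hq)
    exact Prod.ext (RTerm.app_inj h).1 (RTerm.app_inj h).2

/-- A decomposition of `m` is determined by which element is split off. -/
theorem finiteFibres_cons {X : Type*} : FiniteFibres₂ (Multiset.cons (α := X)) := fun m => by
  classical
  refine ((Multiset.finite_toSet m).image fun x => (x, m.erase x)).subset ?_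
  rintro ⟨x, m'⟩ rfl
  exact ⟨x, Multiset.mem_cons_self x m', by simp⟩

/-! ### Operations on vectors of monomials -/

section Bags

variable {S : Type*} [CommSemiring S]

/-- The bilinear-continuous extension of `s, m ↦ s ::ₘ m`. -/
def vcons {X : Type*} (σ : X → S) (μ : Multiset X → S) : Multiset X → S :=
  bin Multiset.cons σ μ

theorem vapp_eq_bin (σ : RTerm → S) (μ : Multiset RTerm → S) :
    vapp σ μ = bin RTerm.app σ μ := rfl

/-- Frees `vbag` from its canonical index type, so that another enumeration, such as `Option Φ` for
a multiset with one more element, can be used. -/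
theorem vbag_eq_finsum {ι : Type*} [Fintype ι] (σ : ι → RTerm → S) (m : Multiset RTerm) :
    vbag (Finset.univ.val.map σ) m =
      ∑ᶠ s : ι → RTerm, (∏ i, σ i (s i)) * basis (Finset.univ.val.map s) m := by
  classical
  set Φ := Finset.univ.val.map σ with hΦ
  obtain ⟨e, he⟩ := exists_equiv_of_map_eq (α := ι) (β := Φ) σ (fun i => (i : RTerm → S))
    (by rw [Multiset.map_univ_coe])
  rw [vbag]
  refine finsum_eq_of_bijective (fun s : Φ → RTerm => s ∘ e)
    (e.arrowCongr (Equiv.refl RTerm)).symm.bijective fun s => ?_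
  congr 1
  · refine (Fintype.prod_equiv e _ _ fun i => ?_).symm
    rw [he, Function.comp_apply]
  · congr 1
    have : (Finset.univ : Finset Φ).val = (Finset.univ : Finset ι).val.map e := by
      rw [← Finset.map_univ_equiv e]; rfl
    rw [this, Multiset.map_map]

theorem vbag_zero : vbag (0 : Multiset (RTerm → S)) = basis 0 := by
  funext m
  refine (vbag_eq_finsum (ι := Empty) (fun i => i.elim) m).trans ?_
  refine (finsum_eq_single _ (fun i => i.elim) fun s hs => ?_).trans ?_
  · exact absurd (Subsingleton.elim _ _) hs
  · simp

/-- Indexed by `Option Φ`, a choice function splits into its value at `none` and its restriction to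
`Φ`. From here on the multilinear bracket is handled by multiset induction and the binary `vcons`.
-/
theorem vbag_cons (φ : RTerm → S) (Φ : Multiset (RTerm → S)) :
    vbag (φ ::ₘ Φ) = vcons φ (vbag Φ) := by
  classical
  have hΦ : φ ::ₘ Φ = Finset.univ.val.map
      (fun o : Option Φ => o.elim φ fun i => (i : RTerm → S)) := by
    have : (Finset.univ : Finset (Option Φ)).val =
        none ::ₘ (Finset.univ : Finset Φ).val.map some := rfl
    rw [this, Multiset.map_cons, Multiset.map_map]
    exact congrArg _ (Multiset.map_univ_coe Φ).symm
  -- A choice function enumerating `m` takes its values in `m`, which leaves finitely many.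
  have hs : SummableFamily fun s : Φ → RTerm => (basis (Finset.univ.val.map s) : _ → S) := by
    refine summable_basis_comp fun m => ?_
    refine (Set.Finite.pi' fun _ : Φ => Multiset.finite_toSet m).subset ?_
    rintro s rfl i
    exact Multiset.mem_map_of_mem _ (Finset.mem_univ i)
  have hv : vbag Φ = ext (fun s : Φ → RTerm => basis (Finset.univ.val.map s))
      (fun s => ∏ i : Φ, (i : RTerm → S) (s i)) := rfl
  have hR : vcons φ (vbag Φ) = ext (fun p : RTerm × (Φ → RTerm) =>
      basis (p.1 ::ₘ Finset.univ.val.map p.2))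
      (tens φ fun s => ∏ i : Φ, (i : RTerm → S) (s i)) := by
    conv_lhs => rw [hv, vcons, ← ext_basis φ, bin_ext finiteFibres_cons summable_basis hs]
    simp only [bin_basis]
  rw [hR, hΦ]
  funext m
  rw [vbag_eq_finsum]
  refine finsum_eq_of_bijective (Equiv.piOptionEquivProd (β := fun _ => RTerm))
    (Equiv.bijective _) fun s => ?_
  have hu : (Finset.univ : Finset (Option Φ)).val =
      none ::ₘ (Finset.univ : Finset Φ).val.map some := rfl
  rw [Fintype.prod_option, hu, Multiset.map_cons, Multiset.map_map]
  rfl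

end Bags
end
end ResLam

namespace ResLam

noncomputable section

section

variable {S : Type*} [CommSemiring S]

/-! ### Monomial vectors -/

theorem rel_of_vbag_ne_zero {Φ : Multiset (RTerm → S)} {m : Multiset RTerm} (h : vbag Φ m ≠ 0) :
    Multiset.Rel (fun φ t => φ t ≠ 0) Φ m := by
  induction Φ using Multiset.induction_on generalizing m with
  | empty =>
    rw [vbag_zero] at h
    rw [eq_of_basis_ne_zero h]
    exact Multiset.Rel.zero
  | cons φ Φ ih =>
    rw [vbag_cons] at h
    obtain ⟨t, m, rfl, ht, hm⟩ := exists_of_bin_ne_zero h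
    exact Multiset.Rel.cons ht (ih hm)

theorem card_of_vbag_ne_zero {Φ : Multiset (RTerm → S)} {m : Multiset RTerm}
    (h : vbag Φ m ≠ 0) : Multiset.card m = Multiset.card Φ :=
  (Multiset.card_eq_card_of_rel (rel_of_vbag_ne_zero h)).symm

theorem vbag_eq_zero {Φ : Multiset (RTerm → S)} (h : 0 ∈ Φ) : vbag Φ = 0 := by
  funext m
  by_contra hm
  obtain ⟨t, -, ht⟩ := Multiset.exists_mem_of_rel_of_mem (rel_of_vbag_ne_zero hm) h
  exact ht rfl

/-- The extension of a function from resource terms to term vectors, to monomials. -/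
def mmap (g : RTerm → RTerm → S) (m : Multiset RTerm) : Multiset RTerm → S := vbag (m.map g)

theorem mmap_zero (g : RTerm → RTerm → S) : mmap g 0 = basis 0 := vbag_zero

theorem mmap_cons (g : RTerm → RTerm → S) (s : RTerm) (m : Multiset RTerm) :
    mmap g (s ::ₘ m) = vcons (g s) (mmap g m) := by
  rw [mmap, Multiset.map_cons, vbag_cons, mmap]

theorem rel_of_mmap_ne_zero {g : RTerm → RTerm → S} {m m' : Multiset RTerm}
    (h : mmap g m m' ≠ 0) : Multiset.Rel (fun s t => g s t ≠ 0) m m' :=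
  Multiset.rel_map_left.1 (rel_of_vbag_ne_zero h)

theorem SummableFamily.mmap {g : RTerm → RTerm → S} (hg : SummableFamily g) :
    SummableFamily (mmap g) := fun m' =>
  (finite_multiset_of_rel m' fun t _ => hg t).subset fun _ hm => rel_of_mmap_ne_zero hm

theorem mmap_congr {g h : RTerm → RTerm → S} {m : Multiset RTerm} (H : ∀ s ∈ m, g s = h s) :
    mmap g m = mmap h m :=
  congrArg vbag (Multiset.map_congr rfl H)

theorem mmap_basis (f : RTerm → RTerm) (m : Multiset RTerm) :
    mmap (fun s => (basis (f s) : RTerm → S)) m = basis (m.map f) := by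
  induction m using Multiset.induction_on with
  | empty => exact mmap_zero _
  | cons s m ih => rw [mmap_cons, ih, vcons, bin_basis, Multiset.map_cons]

theorem ext_mmap_vcons {g : RTerm → RTerm → S} (hg : SummableFamily g) (σ : RTerm → S)
    (μ : Multiset RTerm → S) : ext (mmap g) (vcons σ μ) = vcons (ext g σ) (ext (mmap g) μ) :=
  ext_bin_of_hom finiteFibres_cons finiteFibres_cons hg.mmap hg hg.mmap (mmap_cons g) σ μ

theorem vbag_map_ext {g : RTerm → RTerm → S} (hg : SummableFamily g)
    (Φ : Multiset (RTerm → S)) : vbag (Φ.map (ext g)) = ext (mmap g) (vbag Φ) := by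
  induction Φ using Multiset.induction_on with
  | empty => rw [Multiset.map_zero, vbag_zero, ext_basis_apply, mmap_zero]
  | cons φ Φ ih => rw [Multiset.map_cons, vbag_cons, vbag_cons, ext_mmap_vcons hg, ih]

theorem ext_mmap_mmap {g h : RTerm → RTerm → S} (hg : SummableFamily g) (m : Multiset RTerm) :
    ext (mmap g) (mmap h m) = mmap (fun s => ext g (h s)) m := by
  rw [mmap, ← vbag_map_ext hg, Multiset.map_map]
  rfl

/-! ### Promotion -/

/-- The power `σⁿ` is supported on monomials with `n` elements, so a single `n` contributes. -/
theorem promotion_apply (σ : RTerm → S) (m : Multiset RTerm) :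
    promotion σ m = Ring.inverse ((Multiset.card m).factorial : S) *
      vbag (Multiset.replicate (Multiset.card m) σ) m := by
  refine finsum_eq_single _ (Multiset.card m) fun n hn => ?_
  by_contra hc
  have := card_of_vbag_ne_zero (right_ne_zero_of_mul hc)
  rw [Multiset.card_replicate] at this
  exact hn this.symm

theorem mem_support_of_promotion_ne_zero {σ : RTerm → S} {m : Multiset RTerm}
    (h : promotion σ m ≠ 0) {t : RTerm} (ht : t ∈ m) : σ t ≠ 0 := by
  rw [promotion_apply] at h
  have hr := rel_of_vbag_ne_zero (right_ne_zero_of_mul h)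
  obtain ⟨φ, hφ, hφt⟩ := Multiset.exists_mem_of_rel_of_mem
    (Multiset.rel_flip.2 hr) ht
  rw [Multiset.eq_of_mem_replicate hφ] at hφt
  exact hφt

/-- When only monomials of cardinality `d` reach `y`, a promotion may be replaced by its `d`-th
summand. -/
theorem ext_promotion_apply {Y : Type*} {F : Multiset RTerm → Y → S} (hF : SummableFamily F)
    {y : Y} {d : ℕ} (hd : ∀ m, F m y ≠ 0 → Multiset.card m = d) (σ : RTerm → S) :
    ext F (promotion σ) y = Ring.inverse (d.factorial : S) *
      ext F (vbag (Multiset.replicate d σ)) y := by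
  rw [hF.ext_apply, hF.ext_apply, Finset.mul_sum]
  refine Finset.sum_congr rfl fun m hm => ?_
  have := hd m (by simpa using hm)
  rw [promotion_apply, this, mul_assoc]

/-- Since `mmap g` preserves cardinality, the same coefficient `1/n!` stands on both sides; what
remains is multilinearity for the powers, `vbag_map_ext`. -/
theorem promotion_ext {g : RTerm → RTerm → S} (hg : SummableFamily g) (σ : RTerm → S) :
    promotion (ext g σ) = ext (mmap g) (promotion σ) := by
  funext m
  rw [promotion_apply, ext_promotion_apply hg.mmap (d := Multiset.card m), ← vbag_map_ext hg,
    Multiset.map_replicate]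
  exact fun m' hm' => Multiset.card_eq_card_of_rel (rel_of_mmap_ne_zero hm')

/-! ### Abstractions -/

theorem summable_basis_lam : SummableFamily fun s : RTerm => (basis s.lam : RTerm → S) :=
  summable_basis_comp (finite_fibre_of_injective RTerm.lam_injective)

theorem exists_of_vlam_ne_zero {σ : RTerm → S} {t : RTerm} (h : vlam σ t ≠ 0) :
    ∃ s, t = s.lam ∧ σ s ≠ 0 := by
  obtain ⟨s, hs, hs'⟩ := exists_of_ext_ne_zero h
  exact ⟨s, eq_of_basis_ne_zero hs', hs⟩

theorem vlam_basis (s : RTerm) : vlam (basis s : RTerm → S) = basis s.lam :=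
  ext_basis_apply _ _

theorem ext_vlam_of_hom {h g : RTerm → RTerm → S} (hh : SummableFamily h)
    (hg : SummableFamily g) (H : ∀ s, h s.lam = vlam (g s)) (σ : RTerm → S) :
    ext h (vlam σ) = vlam (ext g σ) := by
  rw [vlam, ext_ext hh summable_basis_lam, vlam, ext_ext summable_basis_lam hg]
  simp only [ext_basis_apply, H]
  rfl

/-! ### Renaming of vectors -/

theorem finite_fibre_liftRen {f : ℕ → ℕ} (hf : ∀ y, {x | f x = y}.Finite) (y : ℕ) :
    {x | liftRen f x = y}.Finite := by
  cases y with
  | zero =>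
    refine (Set.finite_singleton 0).subset fun x hx => ?_
    cases x with
    | zero => rfl
    | succ x => exact absurd hx (Nat.succ_ne_zero _)
  | succ y =>
    refine ((hf y).image Nat.succ).subset fun x hx => ?_
    cases x with
    | zero => exact absurd hx (Nat.succ_ne_zero _).symm
    | succ x => exact ⟨x, Nat.succ.inj hx, rfl⟩

theorem finite_fibre_succ (y : ℕ) : {x | Nat.succ x = y}.Finite :=
  finite_fibre_of_injective Nat.succ_injective y

theorem summable_rename {f : ℕ → ℕ} (hf : ∀ y, {x | f x = y}.Finite) :
    SummableFamily fun s : RTerm => (basis (s.rename f) : RTerm → S) :=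
  summable_basis_comp (RTerm.finite_rename_eq hf)

theorem vrename_zero (f : ℕ → ℕ) : vrename f (0 : RTerm → S) = 0 := ext_zero _

theorem exists_of_vrename_ne_zero {f : ℕ → ℕ} {σ : RTerm → S} {t : RTerm}
    (h : vrename f σ t ≠ 0) : ∃ s, t = s.rename f ∧ σ s ≠ 0 := by
  obtain ⟨s, hs, hs'⟩ := exists_of_ext_ne_zero h
  exact ⟨s, eq_of_basis_ne_zero hs', hs⟩

theorem vrename_basis (f : ℕ → ℕ) (s : RTerm) :
    vrename f (basis s : RTerm → S) = basis (s.rename f) := ext_basis_apply _ _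

theorem vrename_id (σ : RTerm → S) : vrename id σ = σ := by
  simp only [vrename, RTerm.rename_id]
  exact ext_basis σ

theorem vrename_vrename {f g : ℕ → ℕ} (hf : ∀ y, {x | f x = y}.Finite)
    (hg : ∀ y, {x | g x = y}.Finite) (σ : RTerm → S) :
    vrename g (vrename f σ) = vrename (g ∘ f) σ := by
  simp only [vrename, ext_ext (summable_rename hg) (summable_rename hf), ext_basis_apply,
    RTerm.rename_rename]

theorem vrename_vlam {f : ℕ → ℕ} (hf : ∀ y, {x | f x = y}.Finite) (σ : RTerm → S) :
    vrename f (vlam σ) = vlam (vrename (liftRen f) σ) :=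
  ext_vlam_of_hom (summable_rename hf) (summable_rename (finite_fibre_liftRen hf))
    (fun s => by rw [vlam_basis, RTerm.rename_lam]) σ

theorem vrename_vapp {f : ℕ → ℕ} (hf : ∀ y, {x | f x = y}.Finite) (σ : RTerm → S)
    (μ : Multiset RTerm → S) :
    vrename f (vapp σ μ) =
      vapp (vrename f σ) (ext (mmap fun s => basis (s.rename f)) μ) :=
  ext_bin_of_hom finiteFibres_app finiteFibres_app (summable_rename hf) (summable_rename hf)
    (summable_rename hf).mmap
    (fun s m => by rw [mmap_basis, bin_basis, RTerm.rename_app]) σ μ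

/-- Needed with `f = Nat.succ`, because substitution below an abstraction shifts the substituted
term. -/
theorem taylor_rename {f : ℕ → ℕ} (hf : ∀ y, {x | f x = y}.Finite) (M : Term S) :
    taylor (M.rename f) = vrename f (taylor M) := by
  induction M generalizing f with
  | var x => rw [Term.rename, taylor, taylor, vrename_basis, RTerm.rename_var]
  | lam M ih =>
    rw [Term.rename, taylor, taylor, vrename_vlam hf, ih (finite_fibre_liftRen hf)]
  | app M N ihM ihN =>
    rw [Term.rename, taylor, taylor, vrename_vapp hf, ihM hf, ihN hf]
    exact congrArg _ (promotion_ext (summable_rename hf) _)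
  | zero => exact (vrename_zero (S := S) f).symm
  | smul a M ih =>
    rw [Term.rename, taylor, taylor, ih hf]
    exact (ext_smul (summable_rename hf) _ _).symm
  | add M N ihM ihN =>
    rw [Term.rename, taylor, taylor, ihM hf, ihN hf]
    exact (ext_add (summable_rename hf) _ _).symm

/-! ### Free variables of Taylor expansions -/

theorem exists_finite_fv_taylor (M : Term S) :
    ∃ V : Set ℕ, V.Finite ∧ ∀ s, taylor M s ≠ 0 → s.fv ⊆ V := by
  induction M with
  | var x =>
    refine ⟨{x}, Set.finite_singleton x, fun s hs => ?_⟩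
    rw [eq_of_basis_ne_zero hs, RTerm.fv_var]
  | lam M ih =>
    obtain ⟨V, hV, h⟩ := ih
    refine ⟨{y | y + 1 ∈ V}, hV.preimage (add_left_injective 1).injOn, fun s hs => ?_⟩
    obtain ⟨s, rfl, hs'⟩ := exists_of_vlam_ne_zero hs
    rw [RTerm.fv_lam]
    exact fun y hy => h s hs' hy
  | app M N ihM ihN =>
    obtain ⟨V, hV, h⟩ := ihM
    obtain ⟨W, hW, h'⟩ := ihN
    refine ⟨V ∪ W, hV.union hW, fun s hs => ?_⟩
    obtain ⟨s, m, rfl, hs, hm⟩ := exists_of_bin_ne_zero hs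
    rw [RTerm.fv_app]
    refine Set.union_subset_union (h s hs) ?_
    rintro y ⟨t, ht, hy⟩
    exact h' t (mem_support_of_promotion_ne_zero hm ht) hy
  | zero => exact ⟨∅, Set.finite_empty, fun s hs => absurd rfl hs⟩
  | smul a M ih =>
    obtain ⟨V, hV, h⟩ := ih
    exact ⟨V, hV, fun s hs => h s (right_ne_zero_of_mul hs)⟩
  | add M N ihM ihN =>
    obtain ⟨V, hV, h⟩ := ihM
    obtain ⟨W, hW, h'⟩ := ihN
    refine ⟨V ∪ W, hV.union hW, fun s hs => ?_⟩
    by_cases hM : taylor M s = 0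
    · refine (h' s fun hN => hs ?_).trans Set.subset_union_right
      rw [taylor, Pi.add_apply, hM, hN, add_zero]
    · exact (h s hM).trans Set.subset_union_left

theorem isTermVector_taylor (M : Term S) : IsTermVector (taylor M) := by
  obtain ⟨V, hV, h⟩ := exists_finite_fv_taylor M
  exact hV.subset (Set.iUnion₂_subset h)

/-! ### Substitution -/

theorem vsubstTerm_var (y x : ℕ) (σ : RTerm → S) :
    vsubstTerm (.var y) x σ = if y = x then σ else basis (.var y) := by
  unfold vsubstTerm
  rw [RTerm.recurse_var]

theorem vsubstTerm_lam (s : RTerm) (x : ℕ) (σ : RTerm → S) :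
    vsubstTerm s.lam x σ = vlam (vsubstTerm s (x + 1) (vrename Nat.succ σ)) := by
  unfold vsubstTerm
  rw [RTerm.recurse_lam]

theorem vsubstTerm_app (s : RTerm) (m : Multiset RTerm) (x : ℕ) (σ : RTerm → S) :
    vsubstTerm (.app s m) x σ =
      vapp (vsubstTerm s x σ) (mmap (fun t => vsubstTerm t x σ) m) := by
  unfold vsubstTerm
  rw [RTerm.recurse_app, Multiset.map_map]
  rfl

/-- Each replaced occurrence has size `1` and every term has size at least `1`, so the size cannot
drop; free variables other than `x` survive. This gives summability for an arbitrary `σ`. -/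
theorem bounds_of_vsubstTerm_ne_zero {e : RTerm} {x : ℕ} {σ : RTerm → S} {t : RTerm}
    (h : vsubstTerm e x σ t ≠ 0) : e.size ≤ t.size ∧ e.fv ⊆ insert x t.fv := by
  induction e using RTerm.induction generalizing x σ t with
  | hvar y =>
    refine ⟨t.one_le_size, ?_⟩
    rw [RTerm.fv_var, Set.singleton_subset_iff]
    rw [vsubstTerm_var] at h
    split_ifs at h with hy
    · exact Or.inl hy
    · rw [eq_of_basis_ne_zero h]
      exact Or.inr rfl
  | hlam s ih =>
    rw [vsubstTerm_lam] at h
    obtain ⟨t, rfl, ht⟩ := exists_of_vlam_ne_zero h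
    obtain ⟨h1, h2⟩ := ih ht
    rw [RTerm.size_lam, RTerm.size_lam, RTerm.fv_lam, RTerm.fv_lam]
    refine ⟨by omega, fun y hy => ?_⟩
    rcases h2 hy with hy | hy
    · exact Or.inl (Nat.succ.inj hy)
    · exact Or.inr hy
  | happ s m ih ihm =>
    rw [vsubstTerm_app] at h
    obtain ⟨t, m', rfl, ht, hm⟩ := exists_of_bin_ne_zero h
    obtain ⟨h1, h2⟩ := ih ht
    have hm' : (m.map RTerm.size).sum ≤ (m'.map RTerm.size).sum ∧
        ∀ u ∈ m, u.fv ⊆ insert x {y | ∃ u ∈ m', y ∈ u.fv} := by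
      have hr := rel_of_mmap_ne_zero hm
      clear h hm
      induction hr with
      | zero => simp
      | @cons u u' m m' hu hr ihr =>
        obtain ⟨h3, h4⟩ := ihm u (Multiset.mem_cons_self u m) hu
        obtain ⟨h5, h6⟩ := ihr fun v hv => ihm v (Multiset.mem_cons_of_mem hv)
        simp only [Multiset.map_cons, Multiset.sum_cons]
        refine ⟨by omega, fun v hv => ?_⟩
        rcases Multiset.mem_cons.1 hv with rfl | hv
        · refine h4.trans (Set.insert_subset_insert fun y hy => ?_)
          exact ⟨u', Multiset.mem_cons_self _ _, hy⟩
        · refine (h6 v hv).trans (Set.insert_subset_insert ?_)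
          rintro y ⟨w, hw, hy⟩
          exact ⟨w, Multiset.mem_cons_of_mem hw, hy⟩
    rw [RTerm.size_app, RTerm.size_app, RTerm.fv_app, RTerm.fv_app]
    refine ⟨by omega, Set.union_subset ?_ ?_⟩
    · exact h2.trans (Set.insert_subset_insert Set.subset_union_left)
    · rintro y ⟨u, hu, hy⟩
      exact Set.insert_subset_insert Set.subset_union_right (hm'.2 u hu hy)

theorem summable_vsubstTerm (x : ℕ) (σ : RTerm → S) :
    SummableFamily fun e : RTerm => vsubstTerm e x σ := fun t =>
  (RTerm.finite_of_size_le t.size (t.finite_fv.insert x)).subset fun _ h =>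
    bounds_of_vsubstTerm_ne_zero h

theorem vsubst_basis (e : RTerm) (x : ℕ) (σ : RTerm → S) :
    vsubst (basis e) x σ = vsubstTerm e x σ := ext_basis_apply _ _

theorem vsubst_vlam (ε : RTerm → S) (x : ℕ) (σ : RTerm → S) :
    vsubst (vlam ε) x σ = vlam (vsubst ε (x + 1) (vrename Nat.succ σ)) :=
  ext_vlam_of_hom (summable_vsubstTerm x σ) (summable_vsubstTerm _ _)
    (fun s => vsubstTerm_lam s x σ) ε

theorem vsubst_vapp (ε : RTerm → S) (μ : Multiset RTerm → S) (x : ℕ) (σ : RTerm → S) :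
    vsubst (vapp ε μ) x σ =
      vapp (vsubst ε x σ) (ext (mmap fun t => vsubstTerm t x σ) μ) :=
  ext_bin_of_hom finiteFibres_app finiteFibres_app (summable_vsubstTerm x σ)
    (summable_vsubstTerm x σ) (summable_vsubstTerm x σ).mmap
    (fun s m => vsubstTerm_app s m x σ) ε μ

/-- Both sides satisfy the same recursion on `M`; the application case is `promotion_ext` for the
family `e ↦ e[T(N)/x]`. -/
theorem taylor_subst (M : Term S) (x : ℕ) (N : Term S) :
    taylor (M.subst x N) = vsubst (taylor M) x (taylor N) := by
  induction M generalizing x N with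
  | var y =>
    rw [Term.subst, taylor, vsubst_basis, vsubstTerm_var]
    split_ifs <;> rfl
  | lam M ih =>
    rw [Term.subst, taylor, taylor, vsubst_vlam, ih, taylor_rename finite_fibre_succ]
  | app M P ihM ihP =>
    rw [Term.subst, taylor, taylor, vsubst_vapp, ihM, ihP]
    congr 1
    exact promotion_ext (summable_vsubstTerm x _) _
  | zero => exact (ext_zero _).symm
  | smul a M ih =>
    rw [Term.subst, taylor, taylor, ih]
    exact (ext_smul (summable_vsubstTerm x _) _ _).symm
  | add M P ihM ihP =>
    rw [Term.subst, taylor, taylor, ihM, ihP]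
    exact (ext_add (summable_vsubstTerm x _) _ _).symm

/-! ### Substitution for an absent variable, by zero, and for a renamed variable. -/

theorem vsubstTerm_of_deg_eq_zero {e : RTerm} {x : ℕ} (h : e.deg x = 0) (σ : RTerm → S) :
    vsubstTerm e x σ = basis e := by
  induction e using RTerm.induction generalizing x σ with
  | hvar y =>
    rw [RTerm.deg_var] at h
    rw [vsubstTerm_var, if_neg fun hy => by simp [hy] at h]
  | hlam s ih =>
    rw [RTerm.deg_lam] at h
    rw [vsubstTerm_lam, ih h, vlam_basis]
  | happ s m ih ihm =>
    rw [RTerm.deg_app, add_eq_zero, Multiset.sum_eq_zero_iff] at h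
    have hm : mmap (fun t => vsubstTerm t x σ) m = mmap basis m :=
      mmap_congr fun t ht => ihm t ht (h.2 _ (Multiset.mem_map_of_mem _ ht)) σ
    rw [vsubstTerm_app, ih h.1, hm, mmap_basis fun t => t, Multiset.map_id', vapp_eq_bin,
      bin_basis]

theorem vsubstTerm_zero_of_deg_ne_zero {e : RTerm} {x : ℕ} (h : e.deg x ≠ 0) :
    vsubstTerm e x (0 : RTerm → S) = 0 := by
  induction e using RTerm.induction generalizing x with
  | hvar y =>
    rw [RTerm.deg_var] at h
    rw [vsubstTerm_var, if_pos (by by_contra hy; simp [hy] at h)]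
  | hlam s ih =>
    rw [RTerm.deg_lam] at h
    rw [vsubstTerm_lam, vrename_zero, ih h]
    exact ext_zero _
  | happ s m ih ihm =>
    rw [vsubstTerm_app, vapp_eq_bin]
    by_cases hs : s.deg x = 0
    · rw [RTerm.deg_app, hs, zero_add, Ne, Multiset.sum_eq_zero_iff] at h
      push Not at h
      obtain ⟨n, hn, hn0⟩ := h
      obtain ⟨t, ht, rfl⟩ := Multiset.mem_map.1 hn
      rw [mmap, vbag_eq_zero (Multiset.mem_map.2 ⟨t, ht, ihm t ht hn0⟩), bin_zero_right]
    · rw [ih hs, bin_zero_left]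

/-- Replacing `x` by `z` before substituting changes nothing if `g` undoes `f` on the other
variables. No condition on `g z` is needed: every `z` of the renamed term is substituted away. -/
theorem vrename_vsubstTerm_rename {f g : ℕ → ℕ} {x z : ℕ} (hg : ∀ y, {x | g x = y}.Finite)
    (hx : f x = z) (hy : ∀ y, y ≠ x → f y ≠ z ∧ g (f y) = y) (e : RTerm) (τ : RTerm → S) :
    vrename g (vsubstTerm (e.rename f) z τ) = vsubstTerm e x (vrename g τ) := by
  induction e using RTerm.induction generalizing f g x z τ with
  | hvar y =>
    rw [RTerm.rename_var, vsubstTerm_var, vsubstTerm_var]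
    by_cases h : y = x
    · rw [if_pos h, if_pos (h ▸ hx)]
    · rw [if_neg h, if_neg (hy y h).1, vrename_basis, RTerm.rename_var, (hy y h).2]
  | hlam s ih =>
    rw [RTerm.rename_lam, vsubstTerm_lam, vsubstTerm_lam, vrename_vlam hg,
      ih (f := liftRen f) (x := x + 1) (finite_fibre_liftRen hg) (congrArg Nat.succ hx),
      vrename_vrename finite_fibre_succ (finite_fibre_liftRen hg),
      vrename_vrename hg finite_fibre_succ]
    · rfl
    · intro y hyx
      cases y with
      | zero => exact ⟨(Nat.succ_ne_zero z).symm, rfl⟩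
      | succ y =>
        obtain ⟨h1, h2⟩ := hy y fun h => hyx (congrArg Nat.succ h)
        exact ⟨fun h => h1 (Nat.succ.inj h), congrArg Nat.succ h2⟩
  | happ s m ih ihm =>
    rw [RTerm.rename_app, vsubstTerm_app, vsubstTerm_app, vrename_vapp hg, ih hg hx hy,
      ext_mmap_mmap (summable_rename hg)]
    congr 1
    rw [mmap, Multiset.map_map]
    exact congrArg vbag (Multiset.map_congr rfl fun t ht => ihm t ht hg hx hy τ)

end

end

end ResLam

namespace ResLam

noncomputable section

/-! ### Partial derivatives -/

open RTerm

theorem RTerm.pdiff_var (y x : ℕ) (u : RTerm) :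
    pdiff (var y) x u = if y = x then Finsupp.single u 1 else 0 := by
  unfold pdiff
  rw [recurse_var]

theorem RTerm.pdiff_lam (s : RTerm) (x : ℕ) (u : RTerm) :
    pdiff s.lam x u = (pdiff s (x + 1) (u.rename Nat.succ)).mapDomain lam := by
  unfold pdiff
  rw [recurse_lam]

open Classical in
/-- The partial derivative of a monomial. -/
def mpdiff (m : Multiset RTerm) (x : ℕ) (u : RTerm) : Multiset RTerm →₀ ℕ :=
  (m.map fun s => (pdiff s x u).mapDomain fun t => t ::ₘ m.erase s).sum

theorem RTerm.pdiff_app (s : RTerm) (m : Multiset RTerm) (x : ℕ) (u : RTerm) :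
    pdiff (app s m) x u =
      (pdiff s x u).mapDomain (fun s' => app s' m) + (mpdiff m x u).mapDomain (app s) := by
  classical
  unfold pdiff
  rw [recurse_app]
  simp only [Multiset.map_map, Function.comp_def, Multiset.map_id']
  congr 1
  rw [mpdiff, ← Finsupp.mapDomain.addMonoidHom_apply, map_multiset_sum, Multiset.map_map]
  congr 1
  refine Multiset.map_congr rfl fun t _ => ?_
  rw [Function.comp_apply, Finsupp.mapDomain.addMonoidHom_apply, ← Finsupp.mapDomain_comp]
  rfl

/-- Leibniz rule: the derivative acts either on `s` or on an element of `m`. This recursive form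
replaces the clause with `erase`. -/
theorem mpdiff_cons (s : RTerm) (m : Multiset RTerm) (x : ℕ) (u : RTerm) :
    mpdiff (s ::ₘ m) x u =
      (pdiff s x u).mapDomain (fun t => t ::ₘ m) + (mpdiff m x u).mapDomain (Multiset.cons s) := by
  classical
  rw [mpdiff, Multiset.map_cons, Multiset.sum_cons, Multiset.erase_cons_head]
  congr 1
  rw [mpdiff, ← Finsupp.mapDomain.addMonoidHom_apply, map_multiset_sum, Multiset.map_map]
  congr 1
  refine Multiset.map_congr rfl fun t ht => ?_
  rw [Function.comp_apply, Finsupp.mapDomain.addMonoidHom_apply, ← Finsupp.mapDomain_comp,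
    Multiset.erase_cons_tail_of_mem ht]
  congr 1
  funext t'
  exact Multiset.cons_swap _ _ _

section

variable {S : Type*} [CommSemiring S]

/-- The partial derivative of a term, as a vector. -/
def vpdiff (e : RTerm) (x : ℕ) (u : RTerm) : RTerm → S := ofFinsupp (pdiff e x u)

/-- The partial derivative of a monomial, as a vector. -/
def vmpdiff (m : Multiset RTerm) (x : ℕ) (u : RTerm) : Multiset RTerm → S :=
  ofFinsupp (mpdiff m x u)

theorem vpdiff_var (y x : ℕ) (u : RTerm) :
    (vpdiff (.var y) x u : RTerm → S) = if y = x then basis u else 0 := by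
  rw [vpdiff, pdiff_var]
  split_ifs
  · exact ofFinsupp_single u
  · exact ofFinsupp_zero

theorem vpdiff_lam (s : RTerm) (x : ℕ) (u : RTerm) :
    (vpdiff s.lam x u : RTerm → S) = vlam (vpdiff s (x + 1) (u.rename Nat.succ)) := by
  rw [vpdiff, pdiff_lam, ofFinsupp_mapDomain (finite_fibre_of_injective lam_injective)]
  rfl

theorem FiniteFibres₂.left {X Y Z : Type*} {o : X → Y → Z} (ho : FiniteFibres₂ o) (y : Y) (z : Z) :
    {x | o x y = z}.Finite :=
  ((ho z).image Prod.fst).subset fun x hx => ⟨(x, y), hx, rfl⟩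

theorem FiniteFibres₂.right {X Y Z : Type*} {o : X → Y → Z} (ho : FiniteFibres₂ o) (x : X) (z : Z) :
    {y | o x y = z}.Finite :=
  ((ho z).image Prod.snd).subset fun y hy => ⟨(x, y), hy, rfl⟩

theorem vpdiff_app (s : RTerm) (m : Multiset RTerm) (x : ℕ) (u : RTerm) :
    (vpdiff (.app s m) x u : RTerm → S) =
      vapp (vpdiff s x u) (basis m) + vapp (basis s) (vmpdiff m x u) := by
  rw [vpdiff, pdiff_app, ofFinsupp_add, ofFinsupp_mapDomain (finiteFibres_app.left m),
    ofFinsupp_mapDomain (finiteFibres_app.right s), vapp_eq_bin, vapp_eq_bin,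
    bin_basis_right finiteFibres_app, bin_basis_left finiteFibres_app]
  rfl

theorem vmpdiff_zero (x : ℕ) (u : RTerm) : (vmpdiff 0 x u : Multiset RTerm → S) = 0 :=
  ofFinsupp_zero

theorem vmpdiff_cons (s : RTerm) (m : Multiset RTerm) (x : ℕ) (u : RTerm) :
    (vmpdiff (s ::ₘ m) x u : Multiset RTerm → S) =
      vcons (vpdiff s x u) (basis m) + vcons (basis s) (vmpdiff m x u) := by
  rw [vmpdiff, mpdiff_cons, ofFinsupp_add, ofFinsupp_mapDomain (finiteFibres_cons.left m),
    ofFinsupp_mapDomain (finiteFibres_cons.right s), vcons, vcons,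
    bin_basis_right finiteFibres_cons, bin_basis_left finiteFibres_cons]
  rfl

/-- The bounds for terms enter as the hypothesis `H`, so that this can serve as the monomial case
inside their own inductive proof. -/
theorem bounds_of_vmpdiff_ne_zero' {m : Multiset RTerm} {x : ℕ} {u : RTerm}
    (H : ∀ e ∈ m, ∀ t, (vpdiff e x u : RTerm → S) t ≠ 0 → t.size + 1 = e.size + u.size ∧
      t.deg x + 1 = e.deg x + u.deg x ∧ e.fv ⊆ insert x t.fv ∧ u.fv ⊆ t.fv)
    {m' : Multiset RTerm} (h : (vmpdiff m x u : Multiset RTerm → S) m' ≠ 0) :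
    (m'.map size).sum + 1 = (m.map size).sum + u.size ∧
      (m'.map (deg x)).sum + 1 = (m.map (deg x)).sum + u.deg x ∧
      (∀ e ∈ m, e.fv ⊆ insert x {y | ∃ t ∈ m', y ∈ t.fv}) ∧
      u.fv ⊆ {y | ∃ t ∈ m', y ∈ t.fv} := by
  induction m using Multiset.induction_on generalizing m' with
  | empty => rw [vmpdiff_zero] at h; exact absurd rfl h
  | cons s m ih =>
    rw [vmpdiff_cons, Pi.add_apply] at h
    by_cases h1 : (vcons (vpdiff s x u) (basis m) : Multiset RTerm → S) m' = 0
    · rw [h1, zero_add] at h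
      obtain ⟨t, m', rfl, ht, hm⟩ := exists_of_bin_ne_zero h
      rw [eq_of_basis_ne_zero ht]
      obtain ⟨h2, h3, h4, h5⟩ := ih (fun e he => H e (Multiset.mem_cons_of_mem he)) hm
      have h6 : {y | ∃ t ∈ m', y ∈ t.fv} ⊆ {y | ∃ t ∈ s ::ₘ m', y ∈ t.fv} := by
        rintro y ⟨t, ht, hy⟩
        exact ⟨t, Multiset.mem_cons_of_mem ht, hy⟩
      simp only [Multiset.map_cons, Multiset.sum_cons]
      refine ⟨by omega, by omega, fun e he => ?_, h5.trans h6⟩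
      rcases Multiset.mem_cons.1 he with rfl | he
      · exact fun y hy => Or.inr ⟨e, Multiset.mem_cons_self _ _, hy⟩
      · exact (h4 e he).trans (Set.insert_subset_insert h6)
    · obtain ⟨t, m', rfl, ht, hm⟩ := exists_of_bin_ne_zero h1
      rw [eq_of_basis_ne_zero hm]
      obtain ⟨h2, h3, h4, h5⟩ := H s (Multiset.mem_cons_self _ _) t ht
      have h6 : t.fv ⊆ {y | ∃ t' ∈ t ::ₘ m, y ∈ t'.fv} := fun y hy =>
        ⟨t, Multiset.mem_cons_self _ _, hy⟩
      simp only [Multiset.map_cons, Multiset.sum_cons]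
      refine ⟨by omega, by omega, fun e he => ?_, h5.trans h6⟩
      rcases Multiset.mem_cons.1 he with rfl | he
      · exact h4.trans (Set.insert_subset_insert h6)
      · exact fun y hy => Or.inr ⟨e, Multiset.mem_cons_of_mem he, hy⟩

/-- One occurrence of `x`, of size and degree `1`, is replaced by `u`. Sizes and free variables
serve summability, degrees the counting of occurrences. -/
theorem bounds_of_vpdiff_ne_zero {e : RTerm} {x : ℕ} {u t : RTerm}
    (h : (vpdiff e x u : RTerm → S) t ≠ 0) : t.size + 1 = e.size + u.size ∧
      t.deg x + 1 = e.deg x + u.deg x ∧ e.fv ⊆ insert x t.fv ∧ u.fv ⊆ t.fv := by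
  induction e using RTerm.induction generalizing x u t with
  | hvar y =>
    rw [vpdiff_var] at h
    split_ifs at h with hy
    · rw [eq_of_basis_ne_zero h, size_var, deg_var, if_pos hy, fv_var, hy]
      exact ⟨add_comm _ _, add_comm _ _, fun z hz => Or.inl hz, subset_rfl⟩
    · exact absurd rfl h
  | hlam s ih =>
    rw [vpdiff_lam] at h
    obtain ⟨t, rfl, ht⟩ := exists_of_vlam_ne_zero h
    obtain ⟨h1, h2, h3, h4⟩ := ih ht
    rw [size_rename] at h1
    rw [deg_succ_rename_succ] at h2
    rw [fv_rename] at h4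
    rw [size_lam, size_lam, deg_lam, deg_lam, fv_lam, fv_lam]
    refine ⟨by omega, h2, fun y hy => ?_, fun y hy => h4 ⟨y, hy, rfl⟩⟩
    rcases h3 hy with hy | hy
    · exact Or.inl (Nat.succ.inj hy)
    · exact Or.inr hy
  | happ s m ih ihm =>
    rw [vpdiff_app, Pi.add_apply] at h
    by_cases h1 : (vapp (vpdiff s x u) (basis m) : RTerm → S) t = 0
    · rw [h1, zero_add] at h
      obtain ⟨s', m', rfl, hs, hm⟩ := exists_of_bin_ne_zero h
      rw [eq_of_basis_ne_zero hs]
      obtain ⟨h2, h3, h4, h5⟩ := bounds_of_vmpdiff_ne_zero' (fun e he t => ihm e he) hm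
      simp only [size_app, deg_app, fv_app]
      refine ⟨by omega, by omega, Set.union_subset ?_ ?_, h5.trans Set.subset_union_right⟩
      · exact fun y hy => Or.inr (Or.inl hy)
      · rintro y ⟨v, hv, hy⟩
        exact Set.insert_subset_insert Set.subset_union_right (h4 v hv hy)
    · obtain ⟨s', m', rfl, hs, hm⟩ := exists_of_bin_ne_zero h1
      rw [eq_of_basis_ne_zero hm]
      obtain ⟨h2, h3, h4, h5⟩ := ih hs
      simp only [size_app, deg_app, fv_app]
      refine ⟨by omega, by omega, Set.union_subset ?_ ?_, h5.trans Set.subset_union_left⟩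
      · exact h4.trans (Set.insert_subset_insert Set.subset_union_left)
      · exact fun y hy => Or.inr (Or.inr hy)

theorem bounds_of_vmpdiff_ne_zero {m : Multiset RTerm} {x : ℕ} {u : RTerm}
    {m' : Multiset RTerm} (h : (vmpdiff m x u : Multiset RTerm → S) m' ≠ 0) :
    (m'.map size).sum + 1 = (m.map size).sum + u.size ∧
      (m'.map (deg x)).sum + 1 = (m.map (deg x)).sum + u.deg x ∧
      (∀ e ∈ m, e.fv ⊆ insert x {y | ∃ t ∈ m', y ∈ t.fv}) ∧
      u.fv ⊆ {y | ∃ t ∈ m', y ∈ t.fv} :=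
  bounds_of_vmpdiff_ne_zero' (fun _ _ _ => bounds_of_vpdiff_ne_zero) h

/-! ### Summability of derivatives in each argument. -/

theorem finite_fv_monomial (m : Multiset RTerm) : {y | ∃ t ∈ m, y ∈ t.fv}.Finite := by
  refine ((Multiset.finite_toSet m).biUnion fun t _ => t.finite_fv).subset ?_
  rintro y ⟨t, ht, hy⟩
  exact Set.mem_biUnion (show t ∈ {t | t ∈ m} from ht) hy

theorem summable_vpdiff_left (x : ℕ) (u : RTerm) :
    SummableFamily fun e : RTerm => (vpdiff e x u : RTerm → S) := fun t => by
  refine (finite_of_size_le t.size (t.finite_fv.insert x)).subset fun e he => ?_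
  obtain ⟨h1, -, h3, -⟩ := bounds_of_vpdiff_ne_zero he
  have := u.one_le_size
  exact ⟨by omega, h3⟩

theorem summable_vpdiff (e : RTerm) (x : ℕ) :
    SummableFamily (vpdiff e x : RTerm → RTerm → S) := fun t => by
  refine (finite_of_size_le t.size t.finite_fv).subset fun u hu => ?_
  obtain ⟨h1, -, -, h4⟩ := bounds_of_vpdiff_ne_zero hu
  have := e.one_le_size
  exact ⟨by omega, h4⟩

theorem summable_vmpdiff_left (x : ℕ) (u : RTerm) :
    SummableFamily fun m => (vmpdiff m x u : Multiset RTerm → S) := fun m' => by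
  refine (finite_multiset_of_card_le (finite_of_size_le (m'.map size).sum
    ((finite_fv_monomial m').insert x)) (m'.map size).sum).subset fun m hm => ?_
  obtain ⟨h1, -, h3, -⟩ := bounds_of_vmpdiff_ne_zero hm
  have h5 := u.one_le_size
  have h6 := card_le_sum_size m
  refine ⟨by omega, fun e he => ⟨?_, h3 e he⟩⟩
  have := size_le_sum he
  omega

theorem summable_vmpdiff (m : Multiset RTerm) (x : ℕ) :
    SummableFamily (vmpdiff m x : RTerm → Multiset RTerm → S) := fun m' => by
  -- The `+ 1` makes the bound hold without a lower bound on the total size of `m`.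
  refine (finite_of_size_le ((m'.map size).sum + 1) (finite_fv_monomial m')).subset fun u hu => ?_
  obtain ⟨h1, -, -, h4⟩ := bounds_of_vmpdiff_ne_zero hu
  exact ⟨by omega, h4⟩

/-! ### Commutation of partial derivatives -/

theorem vpdiff_eq_zero {e u : RTerm} {x : ℕ} (he : e.deg x = 0) (hu : u.deg x = 0) :
    (vpdiff e x u : RTerm → S) = 0 := by
  funext t
  by_contra h
  obtain ⟨-, h2, -⟩ := bounds_of_vpdiff_ne_zero h
  omega

theorem ext_vpdiff_vlam (ε : RTerm → S) (x : ℕ) (v : RTerm) :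
    ext (fun e => vpdiff e x v) (vlam ε) =
      vlam (ext (fun e => vpdiff e (x + 1) (v.rename Nat.succ)) ε) :=
  ext_vlam_of_hom (summable_vpdiff_left x v) (summable_vpdiff_left _ _)
    (fun s => vpdiff_lam s x v) ε

theorem ext_vpdiff_vapp (ε : RTerm → S) (μ : Multiset RTerm → S) (x : ℕ) (v : RTerm) :
    ext (fun e => vpdiff e x v) (vapp ε μ) =
      vapp (ext (fun e => vpdiff e x v) ε) μ + vapp ε (ext (fun m => vmpdiff m x v) μ) :=
  ext_bin_of_leibniz finiteFibres_app (summable_vpdiff_left x v) (summable_vpdiff_left x v)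
    (summable_vmpdiff_left x v) (fun s m => vpdiff_app s m x v) ε μ

theorem ext_vmpdiff_vcons (ε : RTerm → S) (μ : Multiset RTerm → S) (x : ℕ) (v : RTerm) :
    ext (fun m => vmpdiff m x v) (vcons ε μ) =
      vcons (ext (fun e => vpdiff e x v) ε) μ + vcons ε (ext (fun m => vmpdiff m x v) μ) :=
  ext_bin_of_leibniz finiteFibres_cons (summable_vmpdiff_left x v) (summable_vpdiff_left x v)
    (summable_vmpdiff_left x v) (fun s m => vmpdiff_cons s m x v) ε μ

/-- As `x` is not free in `u` or `v`, the second derivative cannot act inside the term inserted by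
the first; both orders sum over pairs of distinct occurrences in `e`. -/
theorem vpdiff_comm (e : RTerm) {x : ℕ} {u v : RTerm} (hu : u.deg x = 0) (hv : v.deg x = 0) :
    ext (fun t => vpdiff t x v) (vpdiff e x u : RTerm → S) =
      ext (fun t => vpdiff t x u) (vpdiff e x v) := by
  induction e using RTerm.induction generalizing x u v with
  | hvar y =>
    rw [vpdiff_var, vpdiff_var]
    split_ifs
    · rw [ext_basis_apply, ext_basis_apply, vpdiff_eq_zero hu hv, vpdiff_eq_zero hv hu]
    · rw [ext_zero, ext_zero]
  | hlam s ih =>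
    rw [vpdiff_lam, vpdiff_lam, ext_vpdiff_vlam, ext_vpdiff_vlam, ih]
    · rw [deg_succ_rename_succ, hu]
    · rw [deg_succ_rename_succ, hv]
  | happ s m ih ihm =>
    have hm : ext (fun m' => vmpdiff m' x v) (vmpdiff m x u : Multiset RTerm → S) =
        ext (fun m' => vmpdiff m' x u) (vmpdiff m x v) := by
      clear ih
      induction m using Multiset.induction_on with
      | empty => rw [vmpdiff_zero, vmpdiff_zero, ext_zero, ext_zero]
      | cons t m ih =>
        rw [vmpdiff_cons, vmpdiff_cons, ext_add (summable_vmpdiff_left x v),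
          ext_add (summable_vmpdiff_left x u)]
        simp only [ext_vmpdiff_vcons, ext_basis_apply]
        rw [ih fun t' ht' => ihm t' (Multiset.mem_cons_of_mem ht'),
          ihm t (Multiset.mem_cons_self t m) hu hv]
        abel
    rw [vpdiff_app, vpdiff_app, ext_add (summable_vpdiff_left x v),
      ext_add (summable_vpdiff_left x u)]
    simp only [ext_vpdiff_vapp, ext_basis_apply]
    rw [ih hu hv, hm]
    abel

/-! ### Derivatives along vectors, and Euler's identity -/

/-- The partial derivative of a term along a vector. -/
def dirDeriv (e : RTerm) (x : ℕ) (σ : RTerm → S) : RTerm → S := ext (vpdiff e x) σ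

/-- The partial derivative of a monomial along a vector. -/
def mdirDeriv (m : Multiset RTerm) (x : ℕ) (σ : RTerm → S) : Multiset RTerm → S :=
  ext (vmpdiff m x) σ

theorem dirDeriv_vrename (e : RTerm) (x : ℕ) (σ : RTerm → S) :
    dirDeriv e x (vrename Nat.succ σ) = ext (fun u => vpdiff e x (u.rename Nat.succ)) σ := by
  rw [dirDeriv, vrename, ext_ext (summable_vpdiff e x) (summable_rename finite_fibre_succ)]
  simp only [ext_basis_apply]

theorem summable_vpdiff_rename (e : RTerm) (x : ℕ) :
    SummableFamily fun u : RTerm => (vpdiff e x (u.rename Nat.succ) : RTerm → S) := by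
  have := (summable_vpdiff (S := S) e x).ext (summable_rename finite_fibre_succ)
  simpa only [ext_basis_apply] using this

theorem dirDeriv_lam (s : RTerm) (x : ℕ) (σ : RTerm → S) :
    dirDeriv s.lam x σ = vlam (dirDeriv s (x + 1) (vrename Nat.succ σ)) := by
  rw [dirDeriv_vrename, vlam, ext_ext summable_basis_lam (summable_vpdiff_rename s _), dirDeriv]
  congr 1
  funext u
  exact vpdiff_lam s x u

theorem dirDeriv_app (s : RTerm) (m : Multiset RTerm) (x : ℕ) (σ : RTerm → S) :
    dirDeriv (.app s m) x σ =
      vapp (dirDeriv s x σ) (basis m) + vapp (basis s) (mdirDeriv m x σ) := by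
  have h1 : SummableFamily fun u => (bin app (vpdiff s x u) (basis m) : RTerm → S) := by
    have := (summable_basis_comp (S := S) (finiteFibres_app.left m)).ext (summable_vpdiff s x)
    simpa only [← bin_basis_right finiteFibres_app] using this
  have h2 : SummableFamily fun u => (bin app (basis s) (vmpdiff m x u) : RTerm → S) := by
    have := (summable_basis_comp (S := S) (finiteFibres_app.right s)).ext (summable_vmpdiff m x)
    simpa only [← bin_basis_left finiteFibres_app] using this
  rw [vapp_eq_bin, vapp_eq_bin, dirDeriv, dirDeriv, mdirDeriv,
    bin_ext_left finiteFibres_app (summable_vpdiff s x),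
    bin_ext_right finiteFibres_app (summable_vmpdiff m x), ← ext_add_family h1 h2]
  exact congrArg (fun f => ext f σ) (funext fun u => vpdiff_app s m x u)

theorem mdirDeriv_zero (x : ℕ) (σ : RTerm → S) : mdirDeriv 0 x σ = 0 :=
  (congrArg (fun f => ext f σ) (funext fun u => vmpdiff_zero x u)).trans (ext_zero_family σ)

theorem mdirDeriv_cons (s : RTerm) (m : Multiset RTerm) (x : ℕ) (σ : RTerm → S) :
    mdirDeriv (s ::ₘ m) x σ =
      vcons (dirDeriv s x σ) (basis m) + vcons (basis s) (mdirDeriv m x σ) := by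
  have h1 : SummableFamily fun u =>
      (bin Multiset.cons (vpdiff s x u) (basis m) : Multiset RTerm → S) := by
    have := (summable_basis_comp (S := S) (finiteFibres_cons.left m)).ext (summable_vpdiff s x)
    simpa only [← bin_basis_right finiteFibres_cons] using this
  have h2 : SummableFamily fun u =>
      (bin Multiset.cons (basis s) (vmpdiff m x u) : Multiset RTerm → S) := by
    have := (summable_basis_comp (S := S) (finiteFibres_cons.right s)).ext (summable_vmpdiff m x)
    simpa only [← bin_basis_left finiteFibres_cons] using this
  rw [vcons, vcons, dirDeriv, mdirDeriv, mdirDeriv,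
    bin_ext_left finiteFibres_cons (summable_vpdiff s x),
    bin_ext_right finiteFibres_cons (summable_vmpdiff m x), ← ext_add_family h1 h2]
  exact congrArg (fun f => ext f σ) (funext fun u => vmpdiff_cons s m x u)

theorem vsubst_self {x : ℕ} {σ : RTerm → S} (hσ : ∀ u, σ u ≠ 0 → u.deg x = 0) :
    vsubst σ x σ = σ :=
  (ext_congr fun u hu => vsubstTerm_of_deg_eq_zero (hσ u hu) σ).trans (ext_basis σ)

/-- The derivative puts `σ` at one occurrence of `x` and the substitution fills the others, leaving
the inserted `σ` untouched by `hσ`. Each choice of occurrence yields the same vector, and degrees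
add up along the Leibniz rule. -/
theorem vsubst_dirDeriv (e : RTerm) {x : ℕ} {σ : RTerm → S} (hσ : ∀ u, σ u ≠ 0 → u.deg x = 0) :
    vsubst (dirDeriv e x σ) x σ = (e.deg x : S) • vsubstTerm e x σ := by
  induction e using RTerm.induction generalizing x σ with
  | hvar y =>
    have h : dirDeriv (.var y) x σ = if y = x then σ else 0 := by
      rw [dirDeriv]
      split_ifs with hy
      · refine Eq.trans (congrArg (fun f => ext f σ) (funext fun u => ?_)) (ext_basis σ)
        rw [vpdiff_var, if_pos hy]
      · refine Eq.trans (congrArg (fun f => ext f σ) (funext fun u => ?_)) (ext_zero_family σ)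
        rw [vpdiff_var, if_neg hy]
        rfl
    rw [h, deg_var, vsubstTerm_var]
    split_ifs
    · rw [vsubst_self hσ, Nat.cast_one, one_smul]
    · rw [Nat.cast_zero, zero_smul]
      exact ext_zero _
  | hlam s ih =>
    rw [dirDeriv_lam, vsubst_vlam, ih, vsubstTerm_lam, deg_lam]
    · exact ext_smul summable_basis_lam _ _
    · intro u hu
      obtain ⟨u, rfl, hu'⟩ := exists_of_vrename_ne_zero hu
      rw [deg_succ_rename_succ, hσ u hu']
  | happ s m ih ihm =>
    have hm : ext (mmap fun t => vsubstTerm t x σ) (mdirDeriv m x σ) =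
        ((m.map (deg x)).sum : S) • mmap (fun t => vsubstTerm t x σ) m := by
      clear ih
      induction m using Multiset.induction_on with
      | empty =>
        rw [mdirDeriv_zero, ext_zero, Multiset.map_zero, Multiset.sum_zero, Nat.cast_zero,
          zero_smul]
      | cons t m ih =>
        have ht := ihm t (Multiset.mem_cons_self t m) hσ
        rw [vsubst] at ht
        rw [mdirDeriv_cons, ext_add (summable_vsubstTerm x σ).mmap,
          ext_mmap_vcons (summable_vsubstTerm x σ), ext_mmap_vcons (summable_vsubstTerm x σ),
          ht, ext_basis_apply, ext_basis_apply,
          ih fun t' ht' => ihm t' (Multiset.mem_cons_of_mem ht'), mmap_cons, vcons, vcons,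
          bin_smul_left finiteFibres_cons, bin_smul_right finiteFibres_cons, ← add_smul,
          Multiset.map_cons, Multiset.sum_cons, Nat.cast_add]
        rfl
    rw [dirDeriv_app, vsubst, ext_add (summable_vsubstTerm x σ)]
    change vsubst _ x σ + vsubst _ x σ = _
    rw [vsubst_vapp, vsubst_vapp, ih hσ, hm, ext_basis_apply, vsubst_basis, vapp_eq_bin,
      vapp_eq_bin, bin_smul_left finiteFibres_app, bin_smul_right finiteFibres_app, ← add_smul,
      deg_app, Nat.cast_add, vsubstTerm_app]
    rfl

end

end

end ResLam

namespace ResLam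

noncomputable section

/-! ### Iterated derivatives along monomials -/

open RTerm

section

variable {S : Type*} [CommSemiring S]

theorem ofFinsupp_pdiffSum (ε : RTerm →₀ ℕ) (x : ℕ) (u : RTerm) :
    (ofFinsupp (pdiffSum ε x u) : RTerm → S) = ext (fun e => vpdiff e x u) (ofFinsupp ε) :=
  ofFinsupp_sum (summable_vpdiff_left x u) ε

/-- The iterated derivative of a vector along a list of terms. -/
def foldDeriv (x : ℕ) (us : List RTerm) (ε : RTerm → S) : RTerm → S :=
  us.foldl (fun ζ u => ext (fun e => vpdiff e x u) ζ) ε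

theorem ofFinsupp_npdiff (e : RTerm) (x : ℕ) (us : List RTerm) :
    (ofFinsupp (npdiff e x us) : RTerm → S) = foldDeriv x us (basis e) := by
  suffices h : ∀ ε : RTerm →₀ ℕ,
      (ofFinsupp (us.foldl (fun ε u => pdiffSum ε x u) ε) : RTerm → S) =
        foldDeriv x us (ofFinsupp ε) by
    rw [npdiff, h, ofFinsupp_single]
  induction us with
  | nil => exact fun ε => rfl
  | cons u us ih =>
    intro ε
    rw [List.foldl_cons, ih, ofFinsupp_pdiffSum]
    rfl

/-- Summability and linearity are proved together because the inductive step for linearity uses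
both. -/
theorem foldDeriv_eq_ext (x : ℕ) (us : List RTerm) :
    SummableFamily (fun e => foldDeriv x us (basis e : RTerm → S)) ∧
      ∀ ε : RTerm → S, foldDeriv x us ε = ext (fun e => foldDeriv x us (basis e)) ε := by
  induction us with
  | nil => exact ⟨summable_basis, fun ε => (ext_basis ε).symm⟩
  | cons u us ih =>
    have h : ∀ ε : RTerm → S, foldDeriv x (u :: us) ε =
        ext (fun e => foldDeriv x us (basis e)) (ext (fun e => vpdiff e x u) ε) :=
      fun ε => ih.2 _
    simp only [h, ext_basis_apply]
    exact ⟨ih.1.ext (summable_vpdiff_left x u), ext_ext ih.1 (summable_vpdiff_left x u)⟩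

theorem foldDeriv_perm {x : ℕ} {us vs : List RTerm} (h : us.Perm vs)
    (hus : ∀ u ∈ us, u.deg x = 0) (ε : RTerm → S) : foldDeriv x us ε = foldDeriv x vs ε := by
  refine h.foldl_eq' (fun u hu v hv ζ => ?_) ε
  rw [ext_ext (summable_vpdiff_left x v) (summable_vpdiff_left x u),
    ext_ext (summable_vpdiff_left x u) (summable_vpdiff_left x v)]
  exact congrArg (fun f => ext f ζ) (funext fun e => vpdiff_comm e (hus u hu) (hus v hv))

/-- The iterated derivative, with respect to the variable `0`, along a monomial in which
the other variables are shifted. -/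
def bagDeriv (e : RTerm) (m : Multiset RTerm) : RTerm → S :=
  ofFinsupp (npdiff e 0 (m.toList.map fun s => s.rename Nat.succ))

theorem bagDeriv_zero (e : RTerm) : (bagDeriv e 0 : RTerm → S) = basis e := by
  rw [bagDeriv, ofFinsupp_npdiff, Multiset.toList_zero]
  rfl

/-- `toList` may enumerate `u ::ₘ m` in any order. Shifted terms do not contain `0`, so derivatives
along them commute and `u` can be taken first. -/
theorem bagDeriv_cons (e u : RTerm) (m : Multiset RTerm) :
    (bagDeriv e (u ::ₘ m) : RTerm → S) =
      ext (fun t => bagDeriv t m) (vpdiff e 0 (u.rename Nat.succ)) := by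
  have hp : (u ::ₘ m).toList.Perm (u :: m.toList) := by
    rw [← Multiset.coe_eq_coe, Multiset.coe_toList, ← Multiset.cons_coe, Multiset.coe_toList]
  have hd : ∀ v ∈ (u ::ₘ m).toList.map fun s => s.rename Nat.succ, v.deg 0 = 0 := by
    intro v hv
    obtain ⟨w, -, rfl⟩ := List.mem_map.1 hv
    exact deg_zero_rename_succ w
  have h := foldDeriv_perm (S := S) (hp.map fun s => s.rename Nat.succ) hd (basis e)
  simp only [bagDeriv, ofFinsupp_npdiff]
  rw [h, List.map_cons, ← (foldDeriv_eq_ext 0 _).2]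
  exact congrArg (foldDeriv 0 _) (ext_basis_apply _ e)

/-- Each derivative uses up exactly one occurrence of `0`, and inserted terms are never shrunk by
later ones. -/
theorem bounds_of_bagDeriv_ne_zero {e : RTerm} {m : Multiset RTerm} {t : RTerm}
    (h : (bagDeriv e m : RTerm → S) t ≠ 0) :
    e.size ≤ t.size ∧ Multiset.card m + t.deg 0 = e.deg 0 ∧ e.fv ⊆ insert 0 t.fv ∧
      ∀ u ∈ m, u.size ≤ t.size ∧ (u.rename Nat.succ).fv ⊆ insert 0 t.fv := by
  induction m using Multiset.induction_on generalizing e with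
  | empty =>
    rw [bagDeriv_zero] at h
    rw [eq_of_basis_ne_zero h]
    exact ⟨le_rfl, zero_add _, Set.subset_insert _ _,
      fun u hu => absurd hu (Multiset.notMem_zero u)⟩
  | cons u m ih =>
    rw [bagDeriv_cons] at h
    obtain ⟨t', ht', ht⟩ := exists_of_ext_ne_zero h
    obtain ⟨h1, h2, h3, h4⟩ := bounds_of_vpdiff_ne_zero ht'
    obtain ⟨h5, h6, h7, h8⟩ := ih ht
    rw [size_rename] at h1
    rw [deg_zero_rename_succ] at h2
    have h9 := u.one_le_size
    have h10 := e.one_le_size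
    refine ⟨by omega, by rw [Multiset.card_cons]; omega, ?_, fun v hv => ?_⟩
    · refine h3.trans ?_
      rw [Set.insert_subset_iff]
      exact ⟨Or.inl rfl, h7⟩
    · rcases Multiset.mem_cons.1 hv with rfl | hv
      · exact ⟨by omega, h4.trans h7⟩
      · exact h8 v hv

theorem finite_of_multiset_bounds (n : ℕ) {V : Set ℕ} (hV : V.Finite) :
    {p : RTerm × Multiset RTerm | (p.1.size ≤ n ∧ p.1.fv ⊆ V) ∧ Multiset.card p.2 ≤ n ∧
      ∀ u ∈ p.2, u.size ≤ n ∧ u.fv ⊆ V}.Finite :=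
  (finite_of_size_le n hV).prod (finite_multiset_of_card_le (finite_of_size_le n hV) n)

theorem summable_bagDeriv :
    SummableFamily fun p : RTerm × Multiset RTerm => (bagDeriv p.1 p.2 : RTerm → S) := fun t => by
  have hV : (insert 0 t.fv ∪ Nat.succ ⁻¹' insert 0 t.fv).Finite :=
    (t.finite_fv.insert 0).union
      ((t.finite_fv.insert 0).preimage Nat.succ_injective.injOn)
  refine (finite_of_multiset_bounds t.size hV).subset fun p hp => ?_
  -- The cardinality of the monomial is bounded too: it is at most the degree, hence the size, of
  -- the first component.
  obtain ⟨h1, h2, h3, h4⟩ := bounds_of_bagDeriv_ne_zero hp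
  have h5 := deg_le_size 0 p.1
  refine ⟨⟨h1, h3.trans Set.subset_union_left⟩, by omega, fun u hu => ⟨(h4 u hu).1, ?_⟩⟩
  refine Set.Subset.trans ?_ Set.subset_union_right
  intro y hy
  refine (h4 u hu).2 ?_
  rw [fv_rename]
  exact ⟨y, hy, rfl⟩

theorem SummableFamily.snd {X X' Y : Type*} {f : X → X' → Y → S}
    (hf : SummableFamily fun p : X × X' => f p.1 p.2) (x : X) : SummableFamily (f x) := fun y =>
  ((hf y).image Prod.snd).subset fun x' hx' => ⟨(x, x'), hx', rfl⟩

theorem ext_ext_comm {X X' Y : Type*} {f : X → X' → Y → S}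
    (hf : SummableFamily fun p : X × X' => f p.1 p.2) (ξ : X → S) (ζ : X' → S) :
    ext (fun x' => ext (fun x => f x x') ξ) ζ = ext (fun x => ext (f x) ζ) ξ := by
  have hf' : SummableFamily fun p : X' × X => f p.2 p.1 := fun y =>
    ((hf y).image Prod.swap).subset fun p hp => ⟨p.swap, hp, rfl⟩
  rw [← ext₂_eq_ext_ext hf, ← ext₂_eq_ext_ext (f := fun x' x => f x x') hf']
  funext y
  refine finsum_eq_of_bijective Prod.swap Prod.swap_bijective fun p => ?_
  rw [Prod.fst_swap, Prod.snd_swap, mul_comm (ζ p.1)]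

/-- The multilinear substitution along the `n`-th power of a vector, for a term of degree `n`. -/
theorem ext_bagDeriv_vbag_replicate (σ : RTerm → S) (n : ℕ) {e : RTerm} (he : e.deg 0 = n) :
    ext (bagDeriv e) (vbag (Multiset.replicate n σ)) =
      (n.factorial : S) • vsubstTerm e 0 (vrename Nat.succ σ) := by
  induction n generalizing e with
  | zero =>
    rw [Multiset.replicate_zero, vbag_zero, ext_basis_apply, bagDeriv_zero,
      vsubstTerm_of_deg_eq_zero he, Nat.factorial_zero, Nat.cast_one, one_smul]
  | succ n ih =>
    have hσ : ∀ u, vrename Nat.succ σ u ≠ 0 → u.deg 0 = 0 := fun u hu => by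
      obtain ⟨u, rfl, -⟩ := exists_of_vrename_ne_zero hu
      exact deg_zero_rename_succ u
    have hs : SummableFamily (bagDeriv e : Multiset RTerm → RTerm → S) :=
      summable_bagDeriv.snd e
    have hs' : SummableFamily fun p : RTerm × Multiset RTerm =>
        (bagDeriv e (p.1 ::ₘ p.2) : RTerm → S) := by
      have := hs.ext (FiniteFibres₂.summable (S := S) (finiteFibres_cons (X := RTerm)))
      simpa only [ext_basis_apply] using this
    have hv := summable_vsubstTerm (S := S) 0 (vrename Nat.succ σ)
    set μ := vbag (Multiset.replicate n σ) with hμ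
    -- Take the derivative along `u` first: its terms have degree `n`, so the induction hypothesis
    -- turns the other `n` derivatives into `n!` times a substitution.
    have hstep : ∀ u : RTerm, ext (fun m => bagDeriv e (u ::ₘ m)) μ =
        (n.factorial : S) • vsubst (vpdiff e 0 (u.rename Nat.succ)) 0 (vrename Nat.succ σ) := by
      intro u
      simp only [bagDeriv_cons]
      rw [ext_ext_comm summable_bagDeriv, vsubst, ← ext_smul_family hv]
      refine ext_congr fun t ht => ih ?_
      obtain ⟨-, h2, -⟩ := bounds_of_vpdiff_ne_zero ht
      rw [deg_zero_rename_succ] at h2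
      omega
    rw [Multiset.replicate_succ, vbag_cons, vcons, ext_bin finiteFibres_cons hs,
      ext₂_eq_ext_ext hs']
    refine (congrArg (fun f => ext f σ) (funext hstep)).trans ?_
    simp only [vsubst]
    rw [ext_smul_family (hv.ext (summable_vpdiff_rename e 0)),
      ← ext_ext hv (summable_vpdiff_rename e 0), ← dirDeriv_vrename]
    -- The sum over `u` has become the derivative of `e` along the shifted `σ`; Euler's identity
    -- gives the factor `n + 1`.
    have := vsubst_dirDeriv e hσ
    rw [vsubst] at this
    rw [this, smul_smul, he, Nat.factorial_succ, Nat.cast_mul, mul_comm]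

/-! ### Multilinear substitution -/

theorem cast_ext {X Y : Type*} {f : X → Y → ℕ} (hf : SummableFamily f) (ξ : X → ℕ) (y : Y) :
    ((ext f ξ y : ℕ) : S) = ext (fun x y => (f x y : S)) (fun x => (ξ x : S)) y := by
  have hA : ∀ x, ((f x y : ℕ) : S) ≠ 0 → x ∈ (hf y).toFinset := fun x hx => by
    rw [Set.Finite.mem_toFinset]
    intro h
    exact hx (by rw [h, Nat.cast_zero])
  rw [hf.ext_apply, ext_apply_eq_sum hA]
  push_cast
  rfl

theorem cast_basis {X : Type*} (x y : X) : (((basis x : X → ℕ) y : ℕ) : S) = basis x y := by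
  unfold basis
  split_ifs <;> simp

/-- All terms of the derivative have the same degree in `0`, so substituting `0` keeps all of them
or none. -/
theorem vsubst_bagDeriv_zero (e : RTerm) (m : Multiset RTerm) :
    vsubst (bagDeriv e m : RTerm → S) 0 0 =
      if Multiset.card m = e.deg 0 then bagDeriv e m else 0 := by
  split_ifs with h
  · refine (ext_congr fun t ht => ?_).trans (ext_basis _)
    obtain ⟨-, h2, -⟩ := bounds_of_bagDeriv_ne_zero ht
    exact vsubstTerm_of_deg_eq_zero (by omega) 0
  · refine (ext_congr (g := 0) fun t ht => ?_).trans (ext_zero_family _)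
    obtain ⟨-, h2, -⟩ := bounds_of_bagDeriv_ne_zero ht
    exact vsubstTerm_zero_of_deg_ne_zero (by omega)

/-- `unbindVar x` sends both `0` and `x + 1` to `x`. Hence renamings are assumed to have finite
fibres rather than to be injective. -/
theorem finite_fibre_unbindVar (x y : ℕ) : {z | unbindVar x z = y}.Finite := by
  refine (Set.toFinite {0, y + 1}).subset fun z hz => ?_
  cases z with
  | zero => exact Or.inl rfl
  | succ z => exact Or.inr (congrArg Nat.succ hz)

theorem deg_rename_bindVar (e : RTerm) (x : ℕ) : (e.rename (bindVar x)).deg 0 = e.deg x := by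
  have h : bindVar x x = 0 := if_pos rfl
  have := deg_rename (f := bindVar x) (x := x) (fun y hy => ?_) e
  · rwa [h] at this
  · by_contra hyx
    rw [h, bindVar, if_neg hyx] at hy
    exact Nat.succ_ne_zero y hy

theorem lsubstTerm_eq (e : RTerm) (x : ℕ) (m : Multiset RTerm) :
    lsubstTerm e x m = if Multiset.card m = e.deg x then
      vrename (unbindVar x) (bagDeriv (e.rename (bindVar x)) m) else 0 := by
  have h : lsubstTerm e x m =
      vrename (unbindVar x) (vsubst (bagDeriv (e.rename (bindVar x)) m) 0 0) := rfl
  rw [h, vsubst_bagDeriv_zero, deg_rename_bindVar]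
  split_ifs
  · rfl
  · exact vrename_zero _

theorem cast_vrename_bagDeriv (x : ℕ) (e : RTerm) (m : Multiset RTerm) (t : RTerm) :
    ((vrename (unbindVar x) (bagDeriv e m : RTerm → ℕ) t : ℕ) : S) =
      vrename (unbindVar x) (bagDeriv e m) t := by
  rw [vrename, cast_ext (summable_rename (finite_fibre_unbindVar x))]
  simp only [cast_basis]
  rfl

theorem card_of_lsubstTerm_ne_zero {e : RTerm} {x : ℕ} {m : Multiset RTerm} {t : RTerm}
    (h : lsubstTerm e x m t ≠ 0) : Multiset.card m = e.deg x := by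
  by_contra hc
  rw [lsubstTerm_eq, if_neg hc] at h
  exact h rfl

theorem summable_lsubstTerm (x : ℕ) :
    SummableFamily fun p : RTerm × Multiset RTerm => lsubstTerm p.1 x p.2 := fun t => by
  refine (finite_of_multiset_bounds t.size (t.finite_fv.insert x)).subset fun p hp => ?_
  have hc := card_of_lsubstTerm_ne_zero hp
  replace hp : lsubstTerm p.1 x p.2 t ≠ 0 := hp
  rw [lsubstTerm_eq, if_pos hc] at hp
  obtain ⟨t', rfl, ht'⟩ := exists_of_vrename_ne_zero hp
  obtain ⟨h1, h2, h3, h4⟩ := bounds_of_bagDeriv_ne_zero ht'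
  have h5 := deg_le_size x p.1
  have key : ∀ y, y + 1 ∈ insert 0 t'.fv → y ∈ (t'.rename (unbindVar x)).fv := by
    rintro y (hy | hy)
    · exact absurd hy (Nat.succ_ne_zero y)
    · rw [fv_rename]
      exact ⟨y + 1, hy, rfl⟩
  rw [size_rename] at h1
  rw [fv_rename] at h3
  have h6 := t'.size_rename (unbindVar x)
  refine ⟨⟨by omega, fun y hy => ?_⟩, by omega, fun u hu => ⟨by have := (h4 u hu).1; omega, ?_⟩⟩
  · by_cases hyx : y = x
    · exact Or.inl hyx
    · refine Or.inr (key y (h3 ⟨y, hy, if_neg hyx⟩))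
  · intro y hy
    refine Or.inr (key y ((h4 u hu).2 ?_))
    rw [fv_rename]
    exact ⟨y, hy, rfl⟩

/-- Multilinear substitution along a promotion is substitution. -/
theorem ext_lsubstTerm_promotion (hS : ∀ n : ℕ, n ≠ 0 → IsUnit (n : S)) (e : RTerm) (x : ℕ)
    (σ : RTerm → S) :
    ext (fun m t => (lsubstTerm e x m t : S)) (promotion σ) = vsubstTerm e x σ := by
  have hc : ∀ m t, (lsubstTerm e x m t : S) ≠ 0 → lsubstTerm e x m t ≠ 0 := fun m t h h0 =>
    h (by rw [h0, Nat.cast_zero])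
  have hs : SummableFamily fun m t => (lsubstTerm e x m t : S) := fun t =>
    ((summable_lsubstTerm x).snd (f := fun e m => lsubstTerm e x m) e t).subset fun m hm =>
      hc m t hm
  have hr := summable_rename (S := S) (finite_fibre_unbindVar x)
  have hb : SummableFamily (bagDeriv (e.rename (bindVar x)) : _ → RTerm → S) :=
    summable_bagDeriv.snd _
  set μ := vbag (Multiset.replicate (e.deg x) σ) with hμ
  -- On the support of the `d`-th power all monomials have `d` elements, so the final substitution
  -- of `0` has no effect.
  have hμ' : ext (fun m t => (lsubstTerm e x m t : S)) μ =
      ext (fun m => vrename (unbindVar x) (bagDeriv (e.rename (bindVar x)) m)) μ := by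
    refine ext_congr fun m hm => funext fun t => ?_
    have hcard := card_of_vbag_ne_zero hm
    rw [Multiset.card_replicate] at hcard
    rw [lsubstTerm_eq, if_pos hcard, cast_vrename_bagDeriv]
  have hsub : vrename (unbindVar x) (vsubstTerm (e.rename (bindVar x)) 0 (vrename Nat.succ σ)) =
      vsubstTerm e x σ := by
    rw [vrename_vsubstTerm_rename (f := bindVar x) (x := x) (finite_fibre_unbindVar x)
      (if_pos rfl),
      vrename_vrename finite_fibre_succ (finite_fibre_unbindVar x)]
    · exact congrArg _ (vrename_id σ)
    · intro y hy
      rw [bindVar, if_neg hy]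
      exact ⟨Nat.succ_ne_zero y, rfl⟩
  funext t
  rw [ext_promotion_apply hs (d := e.deg x) fun m hm => card_of_lsubstTerm_ne_zero (hc m t hm),
    ← hμ, hμ']
  simp only [vrename]
  -- The factor `d!` produced by the `d` derivatives cancels the promotion coefficient;
  -- invertibility of integers enters here.
  rw [← ext_ext hr hb, hμ, ext_bagDeriv_vbag_replicate σ _ (deg_rename_bindVar e x), ext_smul hr,
    Pi.smul_apply, smul_eq_mul, ← mul_assoc,
    Ring.inverse_mul_cancel _ (hS _ (Nat.factorial_ne_zero _)), one_mul]
  exact congrFun hsub t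

theorem lsubst_promotion (hS : ∀ n : ℕ, n ≠ 0 → IsUnit (n : S)) (ε : RTerm → S) (x : ℕ)
    (σ : RTerm → S) : lsubst ε x (promotion σ) = vsubst ε x σ := by
  have hs : SummableFamily fun p : RTerm × Multiset RTerm =>
      fun t => (lsubstTerm p.1 x p.2 t : S) := fun t =>
    (summable_lsubstTerm x t).subset fun p hp h0 => hp (by
      replace h0 : lsubstTerm p.1 x p.2 t = 0 := h0
      simp only [h0, Nat.cast_zero])
  rw [lsubst, ext₂_eq_ext_ext (f := fun e m t => (lsubstTerm e x m t : S)) hs]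
  simp only [ext_lsubstTerm_promotion hS]
  rfl

end

end

end ResLam

/-! ### Conclusion. -/

theorem lemma4p9 {S : Type*} [CommSemiring S] (hS : ∀ n : ℕ, n ≠ 0 → IsUnit (n : S))
    (M N : ResLam.Term S) (x : ℕ) :
    ResLam.IsTermVector (ResLam.taylor M) ∧
    ResLam.SummableFamily
      (fun p : ResLam.RTerm × Multiset ResLam.RTerm => ResLam.lsubstTerm p.1 x p.2) ∧
    ResLam.SummableFamily
      (fun e : ResLam.RTerm => ResLam.vsubstTerm e x (ResLam.taylor N)) ∧
    ResLam.taylor (M.subst x N) =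
      ResLam.lsubst (ResLam.taylor M) x (ResLam.promotion (ResLam.taylor N)) ∧
    ResLam.lsubst (ResLam.taylor M) x (ResLam.promotion (ResLam.taylor N)) =
      ResLam.vsubst (ResLam.taylor M) x (ResLam.taylor N) := by
  refine ⟨ResLam.isTermVector_taylor M, ResLam.summable_lsubstTerm x,
    ResLam.summable_vsubstTerm x _, ?_, ResLam.lsubst_promotion hS _ x _⟩
  rw [ResLam.lsubst_promotion hS, ResLam.taylor_subst]
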